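/- Fix an angle $\omega$ with $0<\omega<\pi$, and let $P$ be a convex polygon in the plane with $n\ge 2$ vertices (for $n=2$ it is a line segment). An $\omega$-wedge is the set of points between two rays (its arms) that start at a common point (its apex) and form the angle $\omega$; it is minimal for $P$ if it contains $P$ and both arms touch $P$. The $\omega$-cloud of $P$ is the locus of the apices of all minimal $\omega$-wedges for $P$. It is a closed curve, which splits, in clockwise order, into a cyclic sequence of circular arcs: an arc is (the closure of) a maximal connected portion along which the left arm of the minimal wedge touches one fixed vertex of $P$ and the right arm another fixed vertex. The maximal $\omega$-cloud of $P$ is the cyclic sequence of arcs obtained from it by merging all consecutive arcs that lie on the same circle. A circular arc sequence is a cyclic sequence of circular arcs in which consecutive arcs share an endpoint. Then for every circular arc sequence $\Omega^*$ with at least two arcs there is at most one convex polygon $P$ such that $\Omega^*$ is the maximal $\omega$-cloud of $P$. -/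

import Mathlib

/-- A convex polygon in the Euclidean plane `ℂ`, given by its vertices: finitely many, at least two,
points in convex position. (With two vertices it is a line segment.) -/
@[ext]
structure ConvexPolygon where
  verts : Finset ℂ
  two_le_card : 2 ≤ verts.card
  convexIndependent : ConvexIndependent ℝ ((↑) : verts → ℂ)

/-- The region of a polygon: the convex hull of its vertices. -/
def ConvexPolygon.region (P : ConvexPolygon) : Set ℂ :=
  convexHull ℝ (P.verts : Set ℂ)

/-- The closed ray from `q` at angle `α` (counterclockwise from the positive real axis). -/
noncomputable def ray (q : ℂ) (α : ℝ) : Set ℂ :=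
  {z | ∃ s : ℝ, 0 ≤ s ∧ z = q + s * Complex.exp (α * Complex.I)}

/-- Left arm, as seen from the apex `q`, of the `ω`-wedge whose bisector ray has angle `θ`. -/
noncomputable def leftArm (ω : ℝ) (q : ℂ) (θ : ℝ) : Set ℂ :=
  ray q (θ + ω / 2)

/-- Right arm, as seen from the apex `q`, of the `ω`-wedge whose bisector ray has angle `θ`. -/
noncomputable def rightArm (ω : ℝ) (q : ℂ) (θ : ℝ) : Set ℂ :=
  ray q (θ - ω / 2)

/-- The `ω`-wedge (`0 < ω < π`) with apex `q` and direction (bisector ray) `θ`: all points between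
its two arms. -/
noncomputable def wedge (ω : ℝ) (q : ℂ) (θ : ℝ) : Set ℂ :=
  {z | ∃ s t : ℝ, 0 ≤ s ∧ 0 ≤ t ∧
    z = q + s * Complex.exp ((θ - ω / 2 : ℝ) * Complex.I)
          + t * Complex.exp ((θ + ω / 2 : ℝ) * Complex.I)}

/-- The `ω`-wedge with apex `q` and direction `θ` is minimal for `P`: it contains `P`, and both of
its arms touch `P`. -/
def IsMinimalWedge (ω : ℝ) (P : ConvexPolygon) (q : ℂ) (θ : ℝ) : Prop :=
  P.region ⊆ wedge ω q θ ∧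
    (leftArm ω q θ ∩ P.region).Nonempty ∧ (rightArm ω q θ ∩ P.region).Nonempty

/-- The `ω`-cloud of `P` as a point set: the locus of the apices of all minimal `ω`-wedges. -/
def omegaCloud (ω : ℝ) (P : ConvexPolygon) : Set ℂ :=
  {q | ∃ θ : ℝ, IsMinimalWedge ω P q θ}

/-- The points of the `ω`-cloud at which there is a minimal `ω`-wedge whose left arm touches
exactly the vertex `a` of `P` and whose right arm touches exactly the vertex `b`. -/
def touchingPart (ω : ℝ) (P : ConvexPolygon) (a b : ℂ) : Set ℂ :=
  {x ∈ omegaCloud ω P | ∃ θ : ℝ, IsMinimalWedge ω P x θ ∧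
    leftArm ω x θ ∩ (P.verts : Set ℂ) = {a} ∧ rightArm ω x θ ∩ (P.verts : Set ℂ) = {b}}

/-- `γ` is an arc of the `ω`-cloud of `P`, without its endpoints: a maximal connected portion along
which the two arms touch the same two vertices. (For `a = b` the apex would stay at a vertex.) -/
def IsOpenCloudArc (ω : ℝ) (P : ConvexPolygon) (γ : Set ℂ) : Prop :=
  ∃ a b : ℂ, a ≠ b ∧ ∃ x ∈ touchingPart ω P a b,
    γ = connectedComponentIn (touchingPart ω P a b) x

/-- `Γ` is a (closed) circular arc running clockwise from `a` to `b`; a full circle, with `a = b`,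
is allowed. -/
def IsCircularArc (Γ : Set ℂ) (a b : ℂ) : Prop :=
  ∃ (c : ℂ) (r α μ : ℝ), 0 < r ∧ 0 < μ ∧ μ ≤ 2 * Real.pi ∧
    a = c + r * Complex.exp (α * Complex.I) ∧
    b = c + r * Complex.exp ((α - μ : ℝ) * Complex.I) ∧
    Γ = (fun t : ℝ => c + r * Complex.exp ((α - t : ℝ) * Complex.I)) '' Set.Icc 0 μ

/-- `x` is one of the two endpoints of the circular arc `Γ`. -/
def IsArcEndpoint (Γ : Set ℂ) (x : ℂ) : Prop :=
  ∃ y : ℂ, IsCircularArc Γ x y ∨ IsCircularArc Γ y x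

/-- A circular arc sequence: a circular (cyclic) sequence of circular arcs in which every two
consecutive arcs share an endpoint. -/
structure CircularArcSequence where
  arcs : Cycle (Set ℂ)
  isCircularArc : ∀ Γ ∈ arcs, ∃ a b : ℂ, IsCircularArc Γ a b
  share_endpoint : arcs.Chain fun Γ Γ' => ∃ x : ℂ, IsArcEndpoint Γ x ∧ IsArcEndpoint Γ' x

/-- Two arcs have the same supporting circle. -/
def SameSupportingCircle (Γ Γ' : Set ℂ) : Prop :=
  ∃ (c : ℂ) (r : ℝ), 0 < r ∧ Γ ⊆ Metric.sphere c r ∧ Γ' ⊆ Metric.sphere c r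

/-- `Ω` is the `ω`-cloud of `P` as a cyclic sequence: it lists all (closed) arcs of the `ω`-cloud,
each exactly once, in the clockwise order, that is, in the order in which the apex of the minimal
`ω`-wedge meets them while the direction of the wedge makes one clockwise turn. -/
def IsCloudSequence (ω : ℝ) (P : ConvexPolygon) (Ω : Cycle (Set ℂ)) : Prop :=
  ∃ (n : ℕ) (γ : Fin n → Set ℂ) (φ : Fin n → ℝ),
    (∀ s : Set ℂ, IsOpenCloudArc ω P s ↔ ∃ i, γ i = s) ∧
    Function.Injective γ ∧
    StrictAnti φ ∧ (∀ i j, φ i - φ j < 2 * Real.pi) ∧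
    (∀ i, ∃ x ∈ γ i, IsMinimalWedge ω P x (φ i)) ∧
    Ω = (List.ofFn fun i => closure (γ i) : List (Set ℂ))

/-- `Ω'` is the maximal `ω`-cloud of `P`: the `ω`-cloud is cut into blocks of consecutive arcs, each
block on one circle and cyclically consecutive blocks on different circles, and the arcs of every
block are merged into one arc. -/
def IsMaximalCloud (ω : ℝ) (P : ConvexPolygon) (Ω' : CircularArcSequence) : Prop :=
  ∃ blocks : List (List (Set ℂ)),
    IsCloudSequence ω P (blocks.flatten : List (Set ℂ)) ∧
    (∀ B ∈ blocks, B ≠ []) ∧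
    (∀ B ∈ blocks, ∀ Γ ∈ B, ∀ Γ' ∈ B, SameSupportingCircle Γ Γ') ∧
    (2 ≤ blocks.length → (blocks : Cycle (List (Set ℂ))).Chain
      fun B B' => ∀ Γ ∈ B, ∀ Γ' ∈ B', ¬ SameSupportingCircle Γ Γ') ∧
    Ω'.arcs = (blocks.map fun B => ⋃ Γ ∈ B, Γ : List (Set ℂ))

open Real Filter Topology

/-! Put κ = π − ω. The apex of a minimal wedge is the intersection of the supporting lines with
outer normals φ and φ + κ, so the cloud is the image of the closed curve φ ↦ `P.apex κ φ`. Of the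
arc sequence only the union of its arcs matters: it is this image (`IsMaximalCloud.exists_mem_iff`).
It remains to recover a polygon from its apex locus when that locus does not lie on one circle
(`eq_of_apexLocus_eq`).

Let P and Q have the same locus. An apex outside P reaches at least as far as P only in normal
directions from its cone [φ, φ + κ]; therefore one support function cannot be the smaller one at
both φ and φ + κ (`not_support_lt`). So the support functions agree at φ if and only if they agree
at φ + κ, and by the intermediate value theorem they agree somewhere. The set of agreement is
closed; if it is also open, then P = Q.

At a common apex that is a vertex of neither polygon, both apices trace the same circle at the same
speed, so agreement persists (`frequently_support_eq`). At a vertex of both, one arm keeps touching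
that vertex. The only obstruction is a mixed apex, a vertex of exactly one polygon.

A mixed apex at φ + κ forces one at φ with the polygons exchanged (`IsMixedApex.prev`), hence an
endless chain. The inscribed angle theorem puts the apices between consecutive members on a circle
(`left_contact_of_mixed`), and neighbouring circles coincide (`footCenter_eq_of_mixed`). The whole
locus is then on one circle, which two arcs of a maximal cloud exclude. -/

/-! ### Directional components and the inscribed-angle circles -/

/-- The component of `z` in the direction `φ`. -/
noncomputable def proj (z : ℂ) (φ : ℝ) : ℝ := z.re * cos φ + z.im * sin φ

theorem proj_sub (z w : ℂ) (φ : ℝ) : proj (z - w) φ = proj z φ - proj w φ := by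
  simp [proj]; ring

theorem continuous_proj (z : ℂ) : Continuous (proj z) := by unfold proj; fun_prop

theorem proj_add_pi (z : ℂ) (φ : ℝ) : proj z (φ + π) = -proj z φ := by
  simp [proj]; ring

theorem proj_add_two_pi (z : ℂ) (φ : ℝ) : proj z (φ + 2 * π) = proj z φ := by
  simp [proj]

theorem sin_mul_proj (z : ℂ) (φ s t : ℝ) :
    sin t * proj z (φ + s) = sin (t - s) * proj z φ + sin s * proj z (φ + t) := by
  simp only [proj, cos_add, sin_add, sin_sub]
  ring

theorem eq_zero_of_proj {z : ℂ} {φ ψ : ℝ} (h₁ : proj z φ = 0) (h₂ : proj z ψ = 0)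
    (h : sin (ψ - φ) ≠ 0) : z = 0 := by
  have hall : ∀ s, proj z (φ + s) = 0 := fun s => by
    have := sin_mul_proj z φ s (ψ - φ)
    rw [add_sub_cancel, h₁, h₂] at this
    simpa [h] using this
  have h0 := hall (0 - φ)
  have h1 := hall (π / 2 - φ)
  rw [add_sub_cancel] at h0 h1
  apply Complex.ext
  · simpa [proj] using h0
  · simpa [proj] using h1

theorem eq_of_proj {z w : ℂ} {φ ψ : ℝ} (h₁ : proj z φ = proj w φ) (h₂ : proj z ψ = proj w ψ)
    (h : sin (ψ - φ) ≠ 0) : z = w :=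
  sub_eq_zero.1 <| eq_zero_of_proj (by rw [proj_sub, h₁, sub_self])
    (by rw [proj_sub, h₂, sub_self]) h

theorem proj_of_proj_eq_zero {z : ℂ} {φ : ℝ} (h : proj z φ = 0) (n : ℝ) :
    proj z n = sin (n - φ) * proj z (φ + π / 2) := by
  have := sin_mul_proj z φ (n - φ) (π / 2)
  rw [add_sub_cancel, h] at this
  simpa using this

/-- The direction `φ + s` is a nonnegative combination of `φ` and `φ + t`. Conditions on sines, not
on angles, make this usable modulo full turns. -/
theorem proj_nonpos_of_sin {z : ℂ} {φ s t : ℝ} (h₁ : proj z φ ≤ 0) (h₂ : proj z (φ + t) ≤ 0)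
    (ht : 0 < sin t) (hs : 0 ≤ sin s) (hts : 0 ≤ sin (t - s)) : proj z (φ + s) ≤ 0 := by
  have := sin_mul_proj z φ s t
  have h3 := mul_nonpos_of_nonneg_of_nonpos hts h₁
  have h4 := mul_nonpos_of_nonneg_of_nonpos hs h₂
  by_contra hc
  push Not at hc
  nlinarith [mul_pos ht hc]

theorem proj_ofReal_mul_exp (x α φ : ℝ) :
    proj (x * Complex.exp (α * Complex.I)) φ = x * cos (α - φ) := by
  simp [proj, Complex.exp_ofReal_mul_I_re, Complex.exp_ofReal_mul_I_im, cos_sub]; ring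

theorem proj_add (z w : ℂ) (φ : ℝ) : proj (z + w) φ = proj z φ + proj w φ := by
  simp [proj]; ring

/-- The center of the circle traced by `foot κ a b`. -/
noncomputable def footCenter (κ : ℝ) (a b : ℂ) : ℂ :=
  (Complex.exp (2 * κ * Complex.I) * a - b) / (Complex.exp (2 * κ * Complex.I) - 1)

/-- The position of `foot κ a b 0` relative to the center of the circle traced by `foot κ a b`. -/
noncomputable def footRadius (κ : ℝ) (a b : ℂ) : ℂ :=
  Complex.exp (2 * κ * Complex.I) * (starRingEnd ℂ) (a - b) / (Complex.exp (2 * κ * Complex.I) - 1)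

/-- The intersection of the line with normal direction `φ` through `a` and the line with normal
direction `φ + κ` through `b`. -/
noncomputable def foot (κ : ℝ) (a b : ℂ) (φ : ℝ) : ℂ :=
  footCenter κ a b + footRadius κ a b * Complex.exp (2 * φ * Complex.I)

theorem exp_two_mul_sub_one_ne_zero {κ : ℝ} (h : sin κ ≠ 0) :
    Complex.exp (2 * κ * Complex.I) - 1 ≠ 0 := by
  intro h0
  apply h
  have h1 : Complex.exp (2 * κ * Complex.I) = 1 := by linear_combination h0
  have h2 := congrArg Complex.re h1
  rw [show (2 * κ * Complex.I : ℂ) = ((2 * κ : ℝ) : ℂ) * Complex.I by push_cast; ring,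
    Complex.exp_ofReal_mul_I_re, cos_two_mul, Complex.one_re] at h2
  have := sin_sq_add_cos_sq κ
  nlinarith

theorem continuous_foot (κ : ℝ) (a b : ℂ) : Continuous (foot κ a b) := by
  unfold foot; fun_prop

theorem proj_eq_complex (z : ℂ) (φ : ℝ) :
    2 * (proj z φ : ℂ) * Complex.exp (φ * Complex.I) =
      z + (starRingEnd ℂ) z * Complex.exp (2 * φ * Complex.I) := by
  rw [show (2 * φ * Complex.I : ℂ) = φ * Complex.I + φ * Complex.I by ring, Complex.exp_add]
  have hre := Complex.exp_ofReal_mul_I_re φ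
  have him := Complex.exp_ofReal_mul_I_im φ
  have := sin_sq_add_cos_sq φ
  apply Complex.ext <;>
  simp only [proj, Complex.mul_re, Complex.mul_im, Complex.add_re, Complex.add_im, hre, him,
    Complex.ofReal_re, Complex.ofReal_im, Complex.conj_re, Complex.conj_im, Complex.re_ofNat,
    Complex.im_ofNat]
  · linear_combination z.re * this
  · linear_combination z.im * this

/-- By `proj_eq_complex` each line is a linear equation in `q` and its conjugate; eliminating the
conjugate leaves an affine function of exp(2iφ), hence a circle. -/
theorem eq_foot {κ : ℝ} (hκ : sin κ ≠ 0) {a b q : ℂ} {φ : ℝ} (h₁ : proj q φ = proj a φ)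
    (h₂ : proj q (φ + κ) = proj b (φ + κ)) : q = foot κ a b φ := by
  have e1 := proj_eq_complex q φ
  rw [h₁, proj_eq_complex a φ] at e1
  have e2 := proj_eq_complex q (φ + κ)
  rw [h₂, proj_eq_complex b (φ + κ)] at e2
  rw [show (2 * ((φ + κ : ℝ) : ℂ) * Complex.I : ℂ) = 2 * φ * Complex.I + 2 * κ * Complex.I by
    push_cast; ring, Complex.exp_add] at e2
  have hk := exp_two_mul_sub_one_ne_zero hκ
  unfold foot footCenter footRadius
  rw [map_sub]
  generalize Complex.exp (2 * κ * Complex.I) = k at *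
  generalize Complex.exp (2 * φ * Complex.I) = E at *
  field_simp
  linear_combination -k * e1 + e2

theorem exists_proj_eq {κ : ℝ} (hκ : sin κ ≠ 0) (φ x y : ℝ) :
    ∃ q : ℂ, proj q φ = x ∧ proj q (φ + κ) = y := by
  refine ⟨⟨(x * sin (φ + κ) - y * sin φ) / sin κ, (y * cos φ - x * cos (φ + κ)) / sin κ⟩, ?_, ?_⟩
  · simp only [proj]
    field_simp
    rw [cos_add, sin_add]
    linear_combination x * sin κ * sin_sq_add_cos_sq φ
  · simp only [proj]
    field_simp
    rw [cos_add, sin_add]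
    linear_combination y * sin κ * sin_sq_add_cos_sq φ

theorem proj_foot {κ : ℝ} (hκ : sin κ ≠ 0) (a b : ℂ) (φ : ℝ) :
    proj (foot κ a b φ) φ = proj a φ ∧ proj (foot κ a b φ) (φ + κ) = proj b (φ + κ) := by
  obtain ⟨q, h1, h2⟩ := exists_proj_eq hκ φ (proj a φ) (proj b (φ + κ))
  rw [← eq_foot hκ h1 h2]
  exact ⟨h1, h2⟩

theorem foot_self {κ : ℝ} (hκ : sin κ ≠ 0) (a : ℂ) (φ : ℝ) : foot κ a a φ = a :=
  (eq_foot hκ rfl rfl).symm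

theorem norm_exp_two_mul (φ : ℝ) : ‖Complex.exp (2 * φ * Complex.I)‖ = 1 := by
  rw [show (2 * φ * Complex.I : ℂ) = ((2 * φ : ℝ) : ℂ) * Complex.I by push_cast; ring,
    Complex.norm_exp_ofReal_mul_I]

theorem footRadius_ne_zero {κ : ℝ} (hκ : sin κ ≠ 0) {a b : ℂ} (hab : a ≠ b) :
    footRadius κ a b ≠ 0 := by
  unfold footRadius
  refine div_ne_zero (mul_ne_zero (Complex.exp_ne_zero _) ?_) (exp_two_mul_sub_one_ne_zero hκ)
  rw [map_ne_zero]
  exact sub_ne_zero.2 hab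

theorem foot_mem_sphere (κ : ℝ) (a b : ℂ) (φ : ℝ) :
    foot κ a b φ ∈ Metric.sphere (footCenter κ a b) ‖footRadius κ a b‖ := by
  simp [foot, norm_exp_two_mul]

theorem left_mem_sphere {κ : ℝ} (hκ : sin κ ≠ 0) (a b : ℂ) :
    a ∈ Metric.sphere (footCenter κ a b) ‖footRadius κ a b‖ := by
  have hk := exp_two_mul_sub_one_ne_zero hκ
  rw [Metric.mem_sphere, dist_eq_norm, footCenter, footRadius, norm_div, norm_mul,
    norm_exp_two_mul, Complex.norm_conj, one_mul, ← norm_neg (a - b), ← norm_div]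
  congr 1
  field_simp
  ring

theorem right_mem_sphere {κ : ℝ} (hκ : sin κ ≠ 0) (a b : ℂ) :
    b ∈ Metric.sphere (footCenter κ a b) ‖footRadius κ a b‖ := by
  have hk := exp_two_mul_sub_one_ne_zero hκ
  rw [Metric.mem_sphere, dist_eq_norm, footCenter, footRadius, norm_div, norm_mul,
    Complex.norm_conj, ← norm_neg (a - b), ← norm_mul, ← norm_div]
  congr 1
  field_simp
  ring

/-- The circle traced by `foot κ a b` is exactly the set of its values. -/
theorem exists_eq_foot_of_mem_sphere {κ : ℝ} {a b z : ℂ} (hr : footRadius κ a b ≠ 0)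
    (hz : z ∈ Metric.sphere (footCenter κ a b) ‖footRadius κ a b‖) : ∃ φ, z = foot κ a b φ := by
  set w := (z - footCenter κ a b) / footRadius κ a b with hw
  have hn : ‖w‖ = 1 := by
    rw [hw, norm_div, ← dist_eq_norm, Metric.mem_sphere.1 hz, div_self (norm_ne_zero_iff.2 hr)]
  -- The foot turns about the center at twice the speed of `φ`.
  refine ⟨w.arg / 2, ?_⟩
  have h1 := Complex.norm_mul_exp_arg_mul_I w
  rw [hn] at h1
  unfold foot
  rw [show (2 * ((w.arg / 2 : ℝ) : ℂ) * Complex.I : ℂ) = w.arg * Complex.I by push_cast; ring]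
  rw [Complex.ofReal_one, one_mul] at h1
  rw [h1, hw]
  field_simp
  ring

theorem proj_sub_proj (z : ℂ) (x y : ℝ) :
    proj z (2 * x) - proj z (2 * y) = 2 * sin (x - y) * proj z (x + y + π / 2) := by
  simp only [proj, cos_add_pi_div_two, sin_add_pi_div_two]
  rw [cos_two_mul', sin_two_mul, cos_two_mul', sin_two_mul, sin_sub, sin_add, cos_add]
  have hx := sin_sq_add_cos_sq x
  have hy := sin_sq_add_cos_sq y
  linear_combination (z.re * (cos y ^ 2 - sin y ^ 2) + 2 * z.im * sin y * cos y) * hx -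
    (z.re * (cos x ^ 2 - sin x ^ 2) + 2 * z.im * sin x * cos x) * hy

/-- Three points determine the circle. -/
theorem eq_footCenter_of_three {κ r : ℝ} (hκ : sin κ ≠ 0) {a b c : ℂ} (hab : a ≠ b)
    {x y z : ℝ} (hxy : sin (x - y) ≠ 0) (hxz : sin (x - z) ≠ 0) (hyz : sin (y - z) ≠ 0)
    (hx : foot κ a b x ∈ Metric.sphere c r) (hy : foot κ a b y ∈ Metric.sphere c r)
    (hz : foot κ a b z ∈ Metric.sphere c r) : c = footCenter κ a b ∧ r = ‖footRadius κ a b‖ := by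
  set u := (starRingEnd ℂ) (footCenter κ a b - c) * footRadius κ a b with hu
  -- The squared distance to `c` is a constant plus a component of the conjugate of `u` in direction
  -- `2 * x`. Equal values at three points make `u` orthogonal to two independent directions.
  have key : ∀ x, foot κ a b x ∈ Metric.sphere c r → 2 * proj ((starRingEnd ℂ) u) (2 * x) =
      r ^ 2 - ‖footCenter κ a b - c‖ ^ 2 - ‖footRadius κ a b‖ ^ 2 := by
    intro x hx
    rw [Metric.mem_sphere, dist_eq_norm] at hx
    rw [← hx]
    have h1 := norm_exp_two_mul x
    have hre : (Complex.exp (2 * x * Complex.I)).re = cos (2 * x) := by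
      rw [show (2 * x * Complex.I : ℂ) = ((2 * x : ℝ) : ℂ) * Complex.I by push_cast; ring,
        Complex.exp_ofReal_mul_I_re]
    have him : (Complex.exp (2 * x * Complex.I)).im = sin (2 * x) := by
      rw [show (2 * x * Complex.I : ℂ) = ((2 * x : ℝ) : ℂ) * Complex.I by push_cast; ring,
        Complex.exp_ofReal_mul_I_im]
    have hsc := sin_sq_add_cos_sq (2 * x)
    simp only [← Complex.normSq_eq_norm_sq, Complex.normSq_apply, foot, hu, proj, Complex.add_re,
      Complex.add_im, Complex.sub_re, Complex.sub_im, Complex.mul_re, Complex.mul_im, hre, him,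
      Complex.conj_re, Complex.conj_im]
    linear_combination (-(footRadius κ a b).re ^ 2 - (footRadius κ a b).im ^ 2) * hsc
  have e1 : proj ((starRingEnd ℂ) u) (x + y + π / 2) = 0 := by
    have := proj_sub_proj ((starRingEnd ℂ) u) x y
    have hd : proj ((starRingEnd ℂ) u) (2 * x) - proj ((starRingEnd ℂ) u) (2 * y) = 0 := by
      linarith [key x hx, key y hy]
    rw [hd] at this
    simpa [hxy] using this
  have e2 : proj ((starRingEnd ℂ) u) (x + z + π / 2) = 0 := by
    have := proj_sub_proj ((starRingEnd ℂ) u) x z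
    have hd : proj ((starRingEnd ℂ) u) (2 * x) - proj ((starRingEnd ℂ) u) (2 * z) = 0 := by
      linarith [key x hx, key z hz]
    rw [hd] at this
    simpa [hxz] using this
  have hu0 : (starRingEnd ℂ) u = 0 := eq_zero_of_proj e2 e1 (by ring_nf at hyz ⊢; exact hyz)
  have hu1 : u = 0 := by simpa using hu0
  have hc : footCenter κ a b - c = 0 := by
    rw [hu] at hu1
    have := (mul_eq_zero.1 hu1).resolve_right (footRadius_ne_zero hκ hab)
    rwa [map_eq_zero] at this
  have hc' : c = footCenter κ a b := (sub_eq_zero.1 hc).symm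
  refine ⟨hc', ?_⟩
  rw [hc'] at hx
  exact (Metric.mem_sphere.1 hx).symm.trans (Metric.mem_sphere.1 (foot_mem_sphere κ a b x))

/-! ### Support functions, contacts and apices -/

namespace ConvexPolygon

theorem verts_nonempty (P : ConvexPolygon) : P.verts.Nonempty :=
  Finset.card_pos.1 (by have := P.two_le_card; omega)

/-- The support function of a polygon. -/
noncomputable def support (P : ConvexPolygon) (φ : ℝ) : ℝ :=
  P.verts.sup' P.verts_nonempty fun v => proj v φ

/-- The vertex `v` lies on the supporting line with outer normal direction `φ`. -/
def IsContact (P : ConvexPolygon) (φ : ℝ) (v : ℂ) : Prop :=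
  v ∈ P.verts ∧ proj v φ = P.support φ

/-- `q` is the intersection of the supporting lines with normal directions `φ` and `φ + κ`. -/
def IsApex (κ : ℝ) (P : ConvexPolygon) (φ : ℝ) (q : ℂ) : Prop :=
  proj q φ = P.support φ ∧ proj q (φ + κ) = P.support (φ + κ)

/-- The locus of all apices. -/
def apexLocus (κ : ℝ) (P : ConvexPolygon) : Set ℂ := {q | ∃ φ, P.IsApex κ φ q}

variable {P Q : ConvexPolygon} {κ : ℝ}

theorem proj_le_support {v : ℂ} (hv : v ∈ P.verts) (φ : ℝ) : proj v φ ≤ P.support φ :=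
  Finset.le_sup' (fun v => proj v φ) hv

theorem exists_isContact (P : ConvexPolygon) (φ : ℝ) : ∃ v, P.IsContact φ v := by
  obtain ⟨v, hv, h⟩ := Finset.exists_mem_eq_sup' P.verts_nonempty fun v => proj v φ
  exact ⟨v, hv, h.symm⟩

theorem isContact_iff {φ : ℝ} {v : ℂ} :
    P.IsContact φ v ↔ v ∈ P.verts ∧ ∀ w ∈ P.verts, proj w φ ≤ proj v φ := by
  refine ⟨fun h => ⟨h.1, fun w hw => h.2 ▸ proj_le_support hw φ⟩, fun h => ⟨h.1, ?_⟩⟩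
  exact le_antisymm (proj_le_support h.1 φ) (Finset.sup'_le _ _ h.2)

theorem continuous_support (P : ConvexPolygon) : Continuous P.support := by
  unfold support
  exact Continuous.finset_sup'_apply _ fun v _ => continuous_proj v

theorem support_add_two_pi (P : ConvexPolygon) (φ : ℝ) :
    P.support (φ + 2 * π) = P.support φ := by
  simp [support, proj_add_two_pi]

theorem support_add_int_mul (P : ConvexPolygon) (φ : ℝ) (n : ℤ) :
    P.support (φ + n * (2 * π)) = P.support φ :=
  (show Function.Periodic P.support (2 * π) from P.support_add_two_pi).int_mul n φ

theorem isClosed_isContact (P : ConvexPolygon) (v : ℂ) : IsClosed {φ | P.IsContact φ v} := by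
  by_cases hv : v ∈ P.verts
  · simpa [IsContact, hv] using isClosed_eq (continuous_proj v) P.continuous_support
  · simp [IsContact, hv]

theorem IsContact.between {φ s t : ℝ} {v : ℂ} (h₁ : P.IsContact φ v) (h₂ : P.IsContact (φ + t) v)
    (ht : 0 < sin t) (hs : 0 ≤ sin s) (hts : 0 ≤ sin (t - s)) : P.IsContact (φ + s) v := by
  rw [isContact_iff] at *
  refine ⟨h₁.1, fun w hw => ?_⟩
  have := proj_nonpos_of_sin (z := w - v) (by rw [proj_sub]; linarith [h₁.2 w hw])
    (by rw [proj_sub]; linarith [h₂.2 w hw]) ht hs hts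
  rw [proj_sub] at this
  linarith

theorem IsContact.of_mem_Icc {φ t s : ℝ} {v : ℂ} (h₁ : P.IsContact φ v)
    (h₂ : P.IsContact (φ + t) v) (ht : 0 < t) (htπ : t < π) (hs : s ∈ Set.Icc φ (φ + t)) :
    P.IsContact s v := by
  have := h₁.between h₂ (sin_pos_of_pos_of_lt_pi ht htπ) (s := s - φ)
    (sin_nonneg_of_nonneg_of_le_pi (by linarith [hs.1]) (by linarith [hs.2]))
    (sin_nonneg_of_nonneg_of_le_pi (by linarith [hs.2]) (by linarith [hs.1]))
  rwa [add_sub_cancel] at this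

theorem sin_sign_mul_ne_zero {σ t : ℝ} (hσ : σ = 1 ∨ σ = -1) (ht : 0 < t) (htπ : t < π) :
    sin (σ * t) ≠ 0 := by
  have := sin_pos_of_pos_of_lt_pi ht htπ
  rcases hσ with rfl | rfl
  · simpa using this.ne'
  · simpa using this.ne'

/-- On each side of a direction, one vertex is a contact for all nearby directions. -/
theorem exists_isContact_side (P : ConvexPolygon) (φ : ℝ) {σ : ℝ} (hσ : σ = 1 ∨ σ = -1) :
    ∃ v, ∃ ε > 0, ∀ t ∈ Set.Icc 0 ε, P.IsContact (φ + σ * t) v := by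
  -- Pigeonhole over the finitely many vertices; closedness and convexity of the contact directions
  -- then fill the interval.
  have h1 : ∃ v ∈ P.verts, ∃ᶠ t in 𝓝[>] (0 : ℝ), P.IsContact (φ + σ * t) v := by
    by_contra! hc
    have := (eventually_all_finset P.verts).2 hc
    obtain ⟨t, ht⟩ := this.exists
    obtain ⟨v, hv⟩ := P.exists_isContact (φ + σ * t)
    exact ht v hv.1 hv
  obtain ⟨v, -, hf⟩ := h1
  have hlt : ∀ δ > (0 : ℝ), ∀ᶠ t in 𝓝[>] (0 : ℝ), t ∈ Set.Ioo 0 δ := fun δ hδ =>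
    Ioo_mem_nhdsGT hδ
  obtain ⟨ε, hε, hε0, hεπ⟩ := (hf.and_eventually (hlt π pi_pos)).exists
  have h0 : P.IsContact φ v := by
    have hcl := P.isClosed_isContact v
    have htend : Tendsto (fun t => φ + σ * t) (𝓝[>] (0 : ℝ)) (𝓝 φ) := by
      have : Continuous fun t : ℝ => φ + σ * t := by fun_prop
      simpa using (this.tendsto 0).mono_left nhdsWithin_le_nhds
    by_contra hc
    have := htend.eventually (hcl.isOpen_compl.mem_nhds hc)
    obtain ⟨t, h1, h2⟩ := (hf.and_eventually this).exists
    exact h2 h1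
  refine ⟨v, ε, hε0, fun t ht => ?_⟩
  rcases hσ with rfl | rfl
  · simp only [one_mul] at *
    exact h0.of_mem_Icc hε hε0 hεπ ⟨by linarith [ht.1], by linarith [ht.2]⟩
  · have h0' : P.IsContact ((φ + -1 * ε) + ε) v := by simpa using h0
    exact hε.of_mem_Icc h0' hε0 hεπ ⟨by linarith [ht.2], by linarith [ht.1]⟩

/-- If the support functions agree at `φ` and at some nearby directions on one side of `φ`, then
the contacts on that side agree. -/
theorem side_contact_eq {φ σ ε : ℝ} {a b : ℂ} (hσ : σ = 1 ∨ σ = -1) (hε : 0 < ε)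
    (ha : ∀ t ∈ Set.Icc 0 ε, P.IsContact (φ + σ * t) a)
    (hb : ∀ t ∈ Set.Icc 0 ε, Q.IsContact (φ + σ * t) b) (h0 : P.support φ = Q.support φ)
    (hf : ∃ᶠ t in 𝓝[>] (0 : ℝ), P.support (φ + σ * t) = Q.support (φ + σ * t)) : a = b := by
  obtain ⟨t, ht, ht0, htε⟩ := (hf.and_eventually (Ioo_mem_nhdsGT (lt_min hε pi_pos))).exists
  have h1 := ha 0 ⟨le_rfl, hε.le⟩
  have h2 := hb 0 ⟨le_rfl, hε.le⟩
  have htI : t ∈ Set.Icc 0 ε := ⟨ht0.le, htε.le.trans (min_le_left _ _)⟩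
  simp only [mul_zero, add_zero] at h1 h2
  refine eq_of_proj (h1.2.trans (h0.trans h2.2.symm))
    ((ha t htI).2.trans (ht.trans (hb t htI).2.symm)) ?_
  rw [add_sub_cancel_left]
  exact sin_sign_mul_ne_zero hσ ht0 (htε.trans_le (min_le_right _ _))

theorem eventually_support_eq {φ σ : ℝ} (hσ : σ = 1 ∨ σ = -1) (h0 : P.support φ = Q.support φ)
    (hf : ∃ᶠ t in 𝓝[>] (0 : ℝ), P.support (φ + σ * t) = Q.support (φ + σ * t)) :
    ∀ᶠ t in 𝓝[>] (0 : ℝ), P.support (φ + σ * t) = Q.support (φ + σ * t) := by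
  obtain ⟨a, ε, hε, ha⟩ := P.exists_isContact_side φ hσ
  obtain ⟨b, δ, hδ, hb⟩ := Q.exists_isContact_side φ hσ
  have hab := side_contact_eq hσ (lt_min hε hδ)
    (fun t ht => ha t ⟨ht.1, ht.2.trans (min_le_left _ _)⟩)
    (fun t ht => hb t ⟨ht.1, ht.2.trans (min_le_right _ _)⟩) h0 hf
  filter_upwards [Ioo_mem_nhdsGT (lt_min hε hδ)] with t ht
  rw [← (ha t ⟨ht.1.le, ht.2.le.trans (min_le_left _ _)⟩).2,
    ← (hb t ⟨ht.1.le, ht.2.le.trans (min_le_right _ _)⟩).2, hab]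

theorem exists_isApex (P : ConvexPolygon) (hκ : sin κ ≠ 0) (φ : ℝ) : ∃ q, P.IsApex κ φ q :=
  exists_proj_eq hκ φ _ _

theorem IsApex.eq {φ : ℝ} {q q' : ℂ} (hκ : sin κ ≠ 0) (h : P.IsApex κ φ q)
    (h' : P.IsApex κ φ q') : q = q' :=
  eq_of_proj (h.1.trans h'.1.symm) (h.2.trans h'.2.symm) (by rwa [add_sub_cancel_left])

theorem IsApex.eq_foot {φ : ℝ} {q a b : ℂ} (hκ : sin κ ≠ 0) (h : P.IsApex κ φ q)
    (ha : P.IsContact φ a) (hb : P.IsContact (φ + κ) b) : q = foot κ a b φ :=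
  _root_.eq_foot hκ (h.1.trans ha.2.symm) (h.2.trans hb.2.symm)

theorem isApex_foot {φ : ℝ} {a b : ℂ} (hκ : sin κ ≠ 0)
    (ha : P.IsContact φ a) (hb : P.IsContact (φ + κ) b) : P.IsApex κ φ (foot κ a b φ) :=
  ⟨(proj_foot hκ a b φ).1.trans ha.2, (proj_foot hκ a b φ).2.trans hb.2⟩

theorem IsApex.add_int_mul {φ : ℝ} {q : ℂ} (h : P.IsApex κ φ q) (n : ℤ) :
    P.IsApex κ (φ + n * (2 * π)) q := by
  have hp : ∀ φ, proj q (φ + n * (2 * π)) = proj q φ := fun φ =>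
    (show Function.Periodic (proj q) (2 * π) from proj_add_two_pi q).int_mul n φ
  refine ⟨by rw [hp, support_add_int_mul, h.1], ?_⟩
  rw [add_right_comm, hp, support_add_int_mul, h.2]

/-- The contact on the left arm lies forward from the apex. -/
theorem IsApex.left {φ : ℝ} {q a : ℂ} (hκ : 0 < sin κ) (h : P.IsApex κ φ q)
    (ha : P.IsContact φ a) :
    ∃ τ, 0 ≤ τ ∧ (τ = 0 → a = q) ∧ ∀ n, proj a n = proj q n - τ * sin (n - φ) := by
  have h0 : proj (a - q) φ = 0 := by rw [proj_sub, ha.2, h.1, sub_self]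
  have hall := proj_of_proj_eq_zero h0
  have h1 : proj (a - q) (φ + κ) ≤ 0 := by
    rw [proj_sub, h.2]; linarith [proj_le_support ha.1 (φ + κ)]
  rw [hall, add_sub_cancel_left] at h1
  refine ⟨-proj (a - q) (φ + π / 2), ?_, fun h2 => ?_, fun n => ?_⟩
  · by_contra hc; nlinarith
  · exact sub_eq_zero.1 (eq_zero_of_proj h0 (neg_eq_zero.1 h2) (by simp))
  · have := hall n
    rw [proj_sub] at this
    linarith

/-- The contact on the right arm lies forward from the apex. -/
theorem IsApex.right {φ : ℝ} {q b : ℂ} (hκ : 0 < sin κ) (h : P.IsApex κ φ q)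
    (hb : P.IsContact (φ + κ) b) :
    ∃ τ, 0 ≤ τ ∧ (τ = 0 → b = q) ∧ ∀ n, proj b n = proj q n + τ * sin (n - (φ + κ)) := by
  have h0 : proj (b - q) (φ + κ) = 0 := by rw [proj_sub, hb.2, h.2, sub_self]
  have hall := proj_of_proj_eq_zero h0
  have h1 : proj (b - q) φ ≤ 0 := by
    rw [proj_sub, h.1]; linarith [proj_le_support hb.1 φ]
  rw [hall, show φ - (φ + κ) = -κ by ring, sin_neg] at h1
  refine ⟨proj (b - q) (φ + κ + π / 2), ?_, fun h2 => ?_, fun n => ?_⟩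
  · by_contra hc; nlinarith
  · exact sub_eq_zero.1 (eq_zero_of_proj h0 h2 (by simp))
  · have := hall n
    rw [proj_sub] at this
    linarith

/-- Directions in which an apex outside the polygon is not below the polygon are in the closed
normal cone of the wedge. -/
theorem IsApex.sin_of_le {φ n : ℝ} {q : ℂ} (hκ : 0 < sin κ) (h : P.IsApex κ φ q)
    (hq : q ∉ P.verts) (hn : P.support n ≤ proj q n) :
    0 ≤ sin (n - φ) ∧ sin (n - (φ + κ)) ≤ 0 := by
  obtain ⟨a, ha⟩ := P.exists_isContact φ
  obtain ⟨b, hb⟩ := P.exists_isContact (φ + κ)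
  obtain ⟨τ, hτ, hτ0, hτn⟩ := h.left hκ ha
  obtain ⟨υ, hυ, hυ0, hυn⟩ := h.right hκ hb
  have hτ1 : 0 < τ := lt_of_le_of_ne hτ fun h => hq (hτ0 h.symm ▸ ha.1)
  have hυ1 : 0 < υ := lt_of_le_of_ne hυ fun h => hq (hυ0 h.symm ▸ hb.1)
  have h1 := proj_le_support ha.1 n
  have h2 := proj_le_support hb.1 n
  rw [hτn] at h1
  rw [hυn] at h2
  constructor
  · by_contra hc; nlinarith
  · by_contra hc; nlinarith

theorem IsApex.sin_of_lt {φ n : ℝ} {q : ℂ} (hκ : 0 < sin κ) (h : P.IsApex κ φ q)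
    (hn : P.support n < proj q n) : 0 < sin (n - φ) ∧ sin (n - (φ + κ)) < 0 := by
  obtain ⟨a, ha⟩ := P.exists_isContact φ
  obtain ⟨b, hb⟩ := P.exists_isContact (φ + κ)
  obtain ⟨τ, hτ, hτ0, hτn⟩ := h.left hκ ha
  obtain ⟨υ, hυ, hυ0, hυn⟩ := h.right hκ hb
  have h1 := proj_le_support ha.1 n
  have h2 := proj_le_support hb.1 n
  rw [hτn] at h1
  rw [hυn] at h2
  constructor
  · by_contra hc; nlinarith
  · by_contra hc; nlinarith

theorem notMem_of_support_lt {n : ℝ} {q : ℂ} (hn : P.support n < proj q n) : q ∉ P.verts :=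
  fun h => absurd (proj_le_support h n) hn.not_ge

/-! ### Comparison of two support functions -/

/-- Two polygons with the same apex locus cannot be separated at both sides of a wedge. -/
theorem not_support_lt (hκ : 0 < sin κ) (hC : P.apexLocus κ = Q.apexLocus κ) {φ : ℝ}
    (h₁ : P.support φ ≤ Q.support φ) (h₂ : P.support (φ + κ) ≤ Q.support (φ + κ)) :
    P.support φ = Q.support φ ∧ P.support (φ + κ) = Q.support (φ + κ) := by
  obtain ⟨q, hq⟩ := Q.exists_isApex hκ.ne' φ
  obtain ⟨ψ, hψ⟩ : q ∈ P.apexLocus κ := hC ▸ ⟨φ, hq⟩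
  rw [← hq.1] at h₁ ⊢
  rw [← hq.2] at h₂ ⊢
  -- The cones of `q` for `Q` and for `P` have the same width, so `φ` and `φ + κ` cannot both lie in
  -- the cone at `ψ` with one of them strictly inside.
  have e : φ + κ - (ψ + κ) = φ - ψ := by ring
  constructor
  · by_contra hne
    have hlt := lt_of_le_of_ne h₁ hne
    have a1 := (hψ.sin_of_lt hκ hlt).1
    have a2 := (hψ.sin_of_le hκ (notMem_of_support_lt hlt) h₂).2
    rw [e] at a2
    linarith
  · by_contra hne
    have hlt := lt_of_le_of_ne h₂ hne
    have a1 := (hψ.sin_of_lt hκ hlt).2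
    have a2 := (hψ.sin_of_le hκ (notMem_of_support_lt hlt) h₁).1
    rw [e] at a1
    linarith

theorem support_eq_iff (hκ : 0 < sin κ) (hC : P.apexLocus κ = Q.apexLocus κ) (φ : ℝ) :
    P.support φ = Q.support φ ↔ P.support (φ + κ) = Q.support (φ + κ) := by
  constructor <;> intro h
  · rcases le_total (P.support (φ + κ)) (Q.support (φ + κ)) with h' | h'
    · exact (not_support_lt hκ hC h.le h').2
    · exact (not_support_lt hκ hC.symm h.ge h').2.symm
  · rcases le_total (P.support φ) (Q.support φ) with h' | h'
    · exact (not_support_lt hκ hC h' h.le).1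
    · exact (not_support_lt hκ hC.symm h' h.ge).1.symm

/-- The difference of the support functions cannot keep its sign from `0` to `κ`, so it vanishes
somewhere. -/
theorem exists_support_eq (hκ : 0 < sin κ) (hC : P.apexLocus κ = Q.apexLocus κ) :
    ∃ φ, P.support φ = Q.support φ := by
  have hiv : ∀ {P Q : ConvexPolygon}, P.apexLocus κ = Q.apexLocus κ →
      P.support 0 ≤ Q.support 0 → ∃ φ, P.support φ = Q.support φ := by
    intro P Q hC h
    rcases le_total (P.support (0 + κ)) (Q.support (0 + κ)) with h' | h'
    · exact ⟨0, (not_support_lt hκ hC h h').1⟩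
    · have := mem_range_of_exists_le_of_exists_ge (c := (0 : ℝ))
        (P.continuous_support.sub Q.continuous_support) ⟨0, by simpa using h⟩
        ⟨0 + κ, by simpa using h'⟩
      obtain ⟨φ, hφ⟩ := this
      exact ⟨φ, sub_eq_zero.1 hφ⟩
  rcases le_total (P.support 0) (Q.support 0) with h | h
  · exact hiv hC h
  · obtain ⟨φ, hφ⟩ := hiv hC.symm h
    exact ⟨φ, hφ.symm⟩

/-- A polygon is determined by its support function. -/
theorem verts_subset_of_support_eq (h : ∀ φ, P.support φ = Q.support φ) : P.verts ⊆ Q.verts := by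
  intro v hv
  -- Separating `v` from the other vertices gives a direction in which `v` is the only contact of
  -- `P`; the side contact of `Q` there is the same point.
  have hnot : v ∉ convexHull ℝ ((P.verts : Set ℂ) \ {v}) :=
    (convexIndependent_set_iff_notMem_convexHull_sdiff.1 P.convexIndependent) v hv
  have hcl : IsClosed (convexHull ℝ ((P.verts : Set ℂ) \ {v})) :=
    (P.verts.finite_toSet.subset Set.sdiff_subset).isClosed_convexHull ℝ
  obtain ⟨f, u, hfu, huv⟩ := geometric_hahn_banach_closed_point (convex_convexHull ℝ _) hcl hnot
  set w : ℂ := ⟨f 1, f Complex.I⟩ with hw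
  have hf : ∀ z : ℂ, f z = ‖w‖ * proj z w.arg := by
    intro z
    have hz : z = z.re • (1 : ℂ) + z.im • Complex.I := by
      apply Complex.ext <;> simp
    have h1 : ‖w‖ * cos w.arg = f 1 := Complex.norm_mul_cos_arg w
    have h2 : ‖w‖ * sin w.arg = f Complex.I := Complex.norm_mul_sin_arg w
    conv_lhs => rw [hz]
    rw [map_add, map_smul, map_smul, ← h1, ← h2]
    simp only [proj, smul_eq_mul]
    ring
  have hlt : ∀ z ∈ P.verts, z ≠ v → proj z w.arg < proj v w.arg := by
    intro z hz hzv
    have := (hfu z (subset_convexHull ℝ _ ⟨hz, hzv⟩)).trans huv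
    rw [hf, hf] at this
    exact lt_of_mul_lt_mul_left this (norm_nonneg _)
  obtain ⟨a, ε, hε, ha⟩ := P.exists_isContact_side w.arg (Or.inl rfl : (1 : ℝ) = 1 ∨ _)
  obtain ⟨b, δ, hδ, hb⟩ := Q.exists_isContact_side w.arg (Or.inl rfl : (1 : ℝ) = 1 ∨ _)
  have hab := side_contact_eq (Or.inl rfl) (lt_min hε hδ)
    (fun t ht => ha t ⟨ht.1, ht.2.trans (min_le_left _ _)⟩)
    (fun t ht => hb t ⟨ht.1, ht.2.trans (min_le_right _ _)⟩) (h _)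
    (Eventually.frequently (Eventually.of_forall fun t => h _))
  have hav : a = v := by
    have h1 := ha 0 ⟨le_rfl, hε.le⟩
    simp only [mul_zero, add_zero] at h1
    by_contra hne
    have := hlt a h1.1 hne
    linarith [(isContact_iff.1 h1).2 v hv]
  rw [← hav, hab]
  exact (hb 0 ⟨le_rfl, hδ.le⟩).1

theorem eq_of_support_eq (h : ∀ φ, P.support φ = Q.support φ) : P = Q :=
  ConvexPolygon.ext (Finset.Subset.antisymm (verts_subset_of_support_eq h)
    (verts_subset_of_support_eq fun φ => (h φ).symm))

end ConvexPolygon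

/-! ### Local coincidence of the apex curves -/

theorem eventually_Ioo {ε : ℝ} (hε : 0 < ε) : ∀ᶠ t in 𝓝[>] (0 : ℝ), t ∈ Set.Ioo 0 ε :=
  Ioo_mem_nhdsGT hε

/-- A circle that contains infinitely many of the points of an arc traced by `foot` is the circle of
that arc. -/
theorem eq_footCenter_of_frequently {κ r : ℝ} (hκ : sin κ ≠ 0) {a b c : ℂ} (hab : a ≠ b)
    {φ σ : ℝ} (hσ : σ = 1 ∨ σ = -1)
    (hf : ∃ᶠ t in 𝓝[>] (0 : ℝ), foot κ a b (φ + σ * t) ∈ Metric.sphere c r) :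
    c = footCenter κ a b ∧ r = ‖footRadius κ a b‖ := by
  obtain ⟨x, hx, hx0, hxπ⟩ := (hf.and_eventually (eventually_Ioo pi_pos)).exists
  obtain ⟨y, hy, hy0, hyx⟩ := (hf.and_eventually (eventually_Ioo hx0)).exists
  obtain ⟨z, hz, hz0, hzy⟩ := (hf.and_eventually (eventually_Ioo hy0)).exists
  refine eq_footCenter_of_three hκ hab ?_ ?_ ?_ hx hy hz
  all_goals
    rw [add_sub_add_left_eq_sub, ← mul_sub]
    exact ConvexPolygon.sin_sign_mul_ne_zero hσ (by linarith) (by linarith)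

theorem foot_eq_of_radius {κ : ℝ} {a b a' b' : ℂ} (hc : footCenter κ a' b' = footCenter κ a b)
    {φ : ℝ} (h : foot κ a' b' φ = foot κ a b φ) : foot κ a' b' = foot κ a b := by
  have hr : footRadius κ a' b' = footRadius κ a b := by
    unfold foot at h
    rw [hc] at h
    exact mul_right_cancel₀ (Complex.exp_ne_zero _) (add_left_cancel h)
  funext ψ
  rw [foot, foot, hc, hr]

theorem sin_sub_eq_zero_of_foot_eq {κ : ℝ} {a b : ℂ} (hr : footRadius κ a b ≠ 0) {x y : ℝ}
    (h : foot κ a b x = foot κ a b y) : sin (x - y) = 0 := by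
  unfold foot at h
  have h1 := mul_left_cancel₀ hr (add_left_cancel h)
  by_contra hs
  refine exp_two_mul_sub_one_ne_zero hs ?_
  have : Complex.exp (2 * x * Complex.I) =
      Complex.exp (2 * ((x - y : ℝ) : ℂ) * Complex.I) * Complex.exp (2 * y * Complex.I) := by
    rw [← Complex.exp_add]; congr 1; push_cast; ring
  rw [this] at h1
  rw [sub_eq_zero]
  exact mul_right_cancel₀ (Complex.exp_ne_zero _) (h1.trans (one_mul _).symm)

namespace ConvexPolygon

variable {P Q : ConvexPolygon} {κ : ℝ}

/-- The apex as a function of the direction. -/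
noncomputable def apex (κ : ℝ) (P : ConvexPolygon) (φ : ℝ) : ℂ :=
  ⟨(P.support φ * sin (φ + κ) - P.support (φ + κ) * sin φ) / sin κ,
    (P.support (φ + κ) * cos φ - P.support φ * cos (φ + κ)) / sin κ⟩

theorem isApex_apex (P : ConvexPolygon) (hκ : sin κ ≠ 0) (φ : ℝ) :
    P.IsApex κ φ (P.apex κ φ) := by
  constructor
  · simp only [proj, apex]
    field_simp
    rw [cos_add, sin_add]
    linear_combination P.support φ * sin κ * sin_sq_add_cos_sq φ
  · simp only [proj, apex]
    field_simp
    rw [cos_add φ, sin_add]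
    linear_combination P.support (φ + κ) * sin κ * sin_sq_add_cos_sq φ

theorem IsApex.eq_apex {φ : ℝ} {q : ℂ} (hκ : sin κ ≠ 0) (h : P.IsApex κ φ q) :
    q = P.apex κ φ := h.eq hκ (P.isApex_apex hκ φ)

theorem continuous_apex (P : ConvexPolygon) (κ : ℝ) : Continuous (P.apex κ) := by
  have h := P.continuous_support
  have : Continuous fun φ => P.support (φ + κ) := h.comp (by fun_prop)
  have hc : P.apex κ = fun φ => Complex.equivRealProdCLM.symm
      ((P.support φ * sin (φ + κ) - P.support (φ + κ) * sin φ) / sin κ,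
        (P.support (φ + κ) * cos φ - P.support φ * cos (φ + κ)) / sin κ) := by
    funext φ
    apply Complex.ext <;> simp [apex]
  rw [hc]
  exact Complex.equivRealProdCLM.symm.continuous.comp (by fun_prop)

/-- A point outside the polygon is the apex for at most one direction. -/
theorem IsApex.unique {φ ψ : ℝ} {q : ℂ} (hκ : 0 < sin κ) (h : P.IsApex κ φ q)
    (h' : P.IsApex κ ψ q) (hq : q ∉ P.verts) (hψ : ψ ∈ Set.Icc (φ - π) (φ + π)) : ψ = φ := by
  have h1 := h.sin_of_le hκ hq h'.1.ge
  have h2 := h.sin_of_le hκ hq h'.2.ge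
  have e : ψ + κ - (φ + κ) = ψ - φ := by ring
  rw [e] at h2
  have h0 : sin (ψ - φ) = 0 := le_antisymm h2.2 h1.1
  have hs := h1.2
  rw [show ψ - (φ + κ) = (ψ - φ) - κ by ring, sin_sub, h0] at hs
  -- Rules out the opposite direction, where the sine also vanishes.
  have hcos : 0 ≤ cos (ψ - φ) := by by_contra hc; nlinarith
  by_contra hne
  rcases lt_or_gt_of_ne hne with hlt | hlt
  · rcases eq_or_lt_of_le hψ.1 with he | hgt
    · rw [← he] at hcos; simp at hcos; linarith
    · have := sin_neg_of_neg_of_neg_pi_lt (x := ψ - φ) (by linarith) (by linarith)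
      linarith
  · rcases eq_or_lt_of_le hψ.2 with he | hgt
    · rw [he] at hcos; simp at hcos; linarith
    · have := sin_pos_of_pos_of_lt_pi (x := ψ - φ) (by linarith) (by linarith)
      linarith

theorem IsApex.exists_mem_Ico {ψ : ℝ} {q : ℂ} (h : P.IsApex κ ψ q) (φ : ℝ) :
    ∃ ψ' ∈ Set.Ico φ (φ + 2 * π), P.IsApex κ ψ' q := by
  obtain ⟨n, hn, -⟩ := existsUnique_add_zsmul_mem_Ico two_pi_pos ψ φ
  refine ⟨ψ + n * (2 * π), by simpa using hn, h.add_int_mul n⟩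

/-- Near an apex outside the polygon, all apices come from nearby directions. -/
theorem IsApex.eventually_near {φ η : ℝ} {q : ℂ} (hκ : 0 < sin κ) (h : P.IsApex κ φ q)
    (hq : q ∉ P.verts) (hη : 0 < η) :
    ∀ᶠ x in 𝓝 q, x ∈ P.apexLocus κ → ∃ ψ ∈ Set.Ioo (φ - η) (φ + η), P.IsApex κ ψ x := by
  set K := Set.Icc (φ - π) (φ + π) \ Set.Ioo (φ - η) (φ + η) with hK
  have hKc : IsCompact K := isCompact_Icc.diff isOpen_Ioo
  have hcl := (hKc.image (P.continuous_apex κ)).isClosed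
  have hqn : q ∉ P.apex κ '' K := by
    rintro ⟨ψ, hψ, hqψ⟩
    have := h.unique hκ (hqψ ▸ P.isApex_apex hκ.ne' ψ) hq hψ.1
    exact hψ.2 ⟨by linarith, by linarith⟩
  filter_upwards [hcl.isOpen_compl.mem_nhds hqn] with x hx hxC
  obtain ⟨ψ, hψ⟩ := hxC
  obtain ⟨ψ', hψ', hxψ⟩ := hψ.exists_mem_Ico (φ - π)
  refine ⟨ψ', ?_, hxψ⟩
  by_contra hc
  exact hx ⟨ψ', ⟨⟨hψ'.1, by linarith [hψ'.2]⟩, hc⟩, (hxψ.eq_apex hκ.ne').symm⟩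

/-- If the apices coincide at `φ`, at a point which is not a vertex of `Q`, and the apex of `P` moves
on one side of `φ`, then it coincides with the apex of `Q` at directions near `φ` on that side. -/
theorem frequently_support_eq (hκ : 0 < sin κ) (hC : P.apexLocus κ = Q.apexLocus κ) {φ σ ε : ℝ}
    {q a b : ℂ} (hσ : σ = 1 ∨ σ = -1) (hP : P.IsApex κ φ q) (hQ : Q.IsApex κ φ q)
    (hq : q ∉ Q.verts) (hε : 0 < ε) (ha : ∀ t ∈ Set.Icc 0 ε, P.IsContact (φ + σ * t) a)
    (hb : ∀ t ∈ Set.Icc 0 ε, P.IsContact (φ + κ + σ * t) b) (hab : a ≠ b) :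
    ∃ᶠ t in 𝓝[>] (0 : ℝ), P.support (φ + σ * t) = Q.support (φ + σ * t) := by
  have hPfoot : ∀ t ∈ Set.Icc 0 ε, P.IsApex κ (φ + σ * t) (foot κ a b (φ + σ * t)) :=
    fun t ht => isApex_foot hκ.ne' (ha t ht) (by rw [add_right_comm]; exact hb t ht)
  have hq0 : q = foot κ a b φ := by
    have := hPfoot 0 ⟨le_rfl, hε.le⟩
    simp only [mul_zero, add_zero] at this
    exact hP.eq hκ.ne' this
  -- the contacts of `Q` on both sides
  have hside : ∀ τ : ℝ, (τ = 1 ∨ τ = -1) → ∃ a' b' : ℂ, ∃ δ > 0, ∀ s ∈ Set.Icc 0 δ,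
      Q.IsContact (φ + τ * s) a' ∧ Q.IsContact (φ + κ + τ * s) b' := by
    intro τ hτ
    obtain ⟨a', δ, hδ, ha'⟩ := Q.exists_isContact_side φ hτ
    obtain ⟨b', δ', hδ', hb'⟩ := Q.exists_isContact_side (φ + κ) hτ
    exact ⟨a', b', min δ δ', lt_min hδ hδ', fun s hs =>
      ⟨ha' s ⟨hs.1, hs.2.trans (min_le_left _ _)⟩, hb' s ⟨hs.1, hs.2.trans (min_le_right _ _)⟩⟩⟩
  obtain ⟨a₁, b₁, δ₁, hδ₁, h₁⟩ := hside 1 (Or.inl rfl)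
  obtain ⟨a₂, b₂, δ₂, hδ₂, h₂⟩ := hside (-1) (Or.inr rfl)
  set η := min (min δ₁ δ₂) (π / 2) with hη
  have hη0 : 0 < η := lt_min (lt_min hδ₁ hδ₂) (by positivity)
  have hηπ : η ≤ π / 2 := min_le_right _ _
  have htend : Tendsto (fun t => foot κ a b (φ + σ * t)) (𝓝[>] (0 : ℝ)) (𝓝 q) := by
    have : Continuous fun t : ℝ => foot κ a b (φ + σ * t) :=
      (continuous_foot κ a b).comp (by fun_prop)
    have := (this.tendsto 0).mono_left (nhdsWithin_le_nhds (s := Set.Ioi 0))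
    simpa [← hq0] using this
  -- The point reached by `P` is an apex of `Q` for a nearby direction, a priori on either side of
  -- `φ`; one side occurs frequently.
  have hev : ∀ᶠ t in 𝓝[>] (0 : ℝ),
      (∃ s ∈ Set.Ico 0 η, Q.IsApex κ (φ + 1 * s) (foot κ a b (φ + σ * t))) ∨
      (∃ s ∈ Set.Ico 0 η, Q.IsApex κ (φ + -1 * s) (foot κ a b (φ + σ * t))) := by
    filter_upwards [htend.eventually (hQ.eventually_near hκ hq hη0), eventually_Ioo hε]
      with t ht htε
    obtain ⟨ψ, hψ, hψx⟩ := ht (hC ▸ ⟨_, hPfoot t ⟨htε.1.le, htε.2.le⟩⟩)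
    rcases le_total φ ψ with hle | hle
    · exact Or.inl ⟨ψ - φ, ⟨by linarith, by linarith [hψ.2]⟩, by simpa using hψx⟩
    · refine Or.inr ⟨φ - ψ, ⟨by linarith, by linarith [hψ.1]⟩, ?_⟩
      rwa [show φ + -1 * (φ - ψ) = ψ by ring]
  have main : ∀ τ : ℝ, (τ = 1 ∨ τ = -1) → ∀ a' b' : ℂ, (∀ s ∈ Set.Icc 0 η,
      Q.IsContact (φ + τ * s) a' ∧ Q.IsContact (φ + κ + τ * s) b') →
      (∃ᶠ t in 𝓝[>] (0 : ℝ),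
        ∃ s ∈ Set.Ico 0 η, Q.IsApex κ (φ + τ * s) (foot κ a b (φ + σ * t))) →
      ∃ᶠ t in 𝓝[>] (0 : ℝ), P.support (φ + σ * t) = Q.support (φ + σ * t) := by
    intro τ hτ a' b' hc hf
    have hfoot : ∀ s ∈ Set.Ico 0 η, ∀ x, Q.IsApex κ (φ + τ * s) x →
        x = foot κ a' b' (φ + τ * s) := fun s hs x hx => by
      have := hc s ⟨hs.1, hs.2.le⟩
      exact hx.eq_foot hκ.ne' this.1 (by rw [add_right_comm]; exact this.2)
    have hq' : q = foot κ a' b' φ := by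
      have := hfoot 0 ⟨le_rfl, hη0⟩ q (by simpa using hQ)
      simpa using this
    have hcen := (eq_footCenter_of_frequently hκ.ne' hab hσ
      (c := footCenter κ a' b') (r := ‖footRadius κ a' b'‖) (hf.mono fun t ht => by
        obtain ⟨s, hs, hx⟩ := ht
        rw [hfoot s hs _ hx]
        exact foot_mem_sphere _ _ _ _)).1
    -- The circles coincide and both parametrizations pass through `q` at `φ`, so they are equal and
    -- the directions agree modulo π.
    have hfe := foot_eq_of_radius hcen (hq'.symm.trans hq0)
    refine (hf.and_eventually ((eventually_Ioo hε).and
      (eventually_Ioo (by positivity : 0 < π / 2)))).mono fun t ht => ?_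
    obtain ⟨⟨s, hs, hx⟩, htε, htπ⟩ := ht
    have hx' := hfoot s hs _ hx
    rw [hfe] at hx'
    have hsin := sin_sub_eq_zero_of_foot_eq (footRadius_ne_zero hκ.ne' hab) hx'
    rw [add_sub_add_left_eq_sub] at hsin
    have heq : σ * t = τ * s := by
      have hlt : |σ * t - τ * s| < π := by
        have h1 : |σ * t| < π / 2 := by
          rcases hσ with rfl | rfl <;> simp [abs_of_pos htπ.1, htπ.2]
        have h2 : |τ * s| < π / 2 := by
          rcases hτ with rfl | rfl <;> simp [abs_of_nonneg hs.1] <;> linarith [hs.2]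
        linarith [abs_sub (σ * t) (τ * s)]
      have := abs_lt.1 hlt
      have := (sin_eq_zero_iff_of_lt_of_lt this.1 this.2).1 hsin
      linarith
    rw [← heq] at hx
    rw [← hx.1, ← (hPfoot t ⟨htε.1.le, htε.2.le⟩).1]
  rcases frequently_or_distrib.1 hev.frequently with hf | hf
  · exact main 1 (Or.inl rfl) a₁ b₁ (fun s hs =>
      h₁ s ⟨hs.1, hs.2.trans ((min_le_left _ _).trans (min_le_left _ _))⟩) hf
  · exact main (-1) (Or.inr rfl) a₂ b₂ (fun s hs =>
      h₂ s ⟨hs.1, hs.2.trans ((min_le_left _ _).trans (min_le_right _ _))⟩) hf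

/-- The contacts of both arms on one side of a direction. -/
theorem exists_side_contacts (P : ConvexPolygon) (κ φ : ℝ) {σ : ℝ} (hσ : σ = 1 ∨ σ = -1) :
    ∃ a b, ∃ ε > 0, ∀ t ∈ Set.Icc 0 ε,
      P.IsContact (φ + σ * t) a ∧ P.IsContact (φ + κ + σ * t) b := by
  obtain ⟨a', δ, hδ, ha'⟩ := P.exists_isContact_side φ hσ
  obtain ⟨b', δ', hδ', hb'⟩ := P.exists_isContact_side (φ + κ) hσ
  exact ⟨a', b', min δ δ', lt_min hδ hδ', fun s hs =>
    ⟨ha' s ⟨hs.1, hs.2.trans (min_le_left _ _)⟩, hb' s ⟨hs.1, hs.2.trans (min_le_right _ _)⟩⟩⟩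

/-- When the apex is a vertex, that vertex is the left contact counterclockwise of the direction. -/
theorem IsApex.left_side_eq {φ ε : ℝ} {q a : ℂ} (hκ : 0 < sin κ) (h : P.IsApex κ φ q)
    (hq : q ∈ P.verts) (hε : 0 < ε) (ha : ∀ t ∈ Set.Icc 0 ε, P.IsContact (φ + 1 * t) a) :
    a = q := by
  have ha0 := ha 0 ⟨le_rfl, hε.le⟩
  simp only [mul_zero, add_zero] at ha0
  obtain ⟨τ, hτ, hτ0, hτn⟩ := h.left hκ ha0
  refine hτ0 ?_
  have ht0 : 0 < min ε (π / 2) := lt_min hε (by positivity)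
  have h1 := (ha (min ε (π / 2)) ⟨ht0.le, min_le_left _ _⟩).2
  have h2 := proj_le_support hq (φ + 1 * min ε (π / 2))
  rw [← h1, hτn, one_mul, add_sub_cancel_left] at h2
  have := sin_pos_of_pos_of_lt_pi ht0 ((min_le_right _ _).trans_lt (by linarith [pi_pos]))
  by_contra hne
  have : 0 < τ := lt_of_le_of_ne hτ (Ne.symm hne)
  nlinarith

/-- When the apex is a vertex, that vertex is the right contact clockwise of the direction. -/
theorem IsApex.right_side_eq {φ ε : ℝ} {q b : ℂ} (hκ : 0 < sin κ) (h : P.IsApex κ φ q)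
    (hq : q ∈ P.verts) (hε : 0 < ε)
    (hb : ∀ t ∈ Set.Icc 0 ε, P.IsContact (φ + κ + -1 * t) b) : b = q := by
  have hb0 := hb 0 ⟨le_rfl, hε.le⟩
  simp only [mul_zero, add_zero] at hb0
  obtain ⟨τ, hτ, hτ0, hτn⟩ := h.right hκ hb0
  refine hτ0 ?_
  have ht0 : 0 < min ε (π / 2) := lt_min hε (by positivity)
  have h1 := (hb (min ε (π / 2)) ⟨ht0.le, min_le_left _ _⟩).2
  have h2 := proj_le_support hq (φ + κ + -1 * min ε (π / 2))
  rw [← h1, hτn, add_sub_cancel_left, neg_one_mul, sin_neg] at h2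
  have := sin_pos_of_pos_of_lt_pi ht0 ((min_le_right _ _).trans_lt (by linarith [pi_pos]))
  by_contra hne
  have : 0 < τ := lt_of_le_of_ne hτ (Ne.symm hne)
  nlinarith

/-! ### Mixed apices as the only obstruction -/

/-- The apices of `P` and `Q` coincide in a point which is a vertex of `P` but not of `Q`. -/
structure IsMixedApex (κ : ℝ) (P Q : ConvexPolygon) (φ : ℝ) (q : ℂ) : Prop where
  left : P.IsApex κ φ q
  right : Q.IsApex κ φ q
  mem : q ∈ P.verts
  notMem : q ∉ Q.verts

/-- Without mixed apices, the support functions agree on both sides of every direction at which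
they agree. -/
theorem eventually_support_eq_of_not_mixed (hκ : 0 < sin κ)
    (hC : P.apexLocus κ = Q.apexLocus κ) (h₁ : ∀ φ q, ¬ IsMixedApex κ P Q φ q)
    (h₂ : ∀ φ q, ¬ IsMixedApex κ Q P φ q) {φ σ : ℝ} (hσ : σ = 1 ∨ σ = -1)
    (h : P.support φ = Q.support φ) :
    ∀ᶠ t in 𝓝[>] (0 : ℝ), P.support (φ + σ * t) = Q.support (φ + σ * t) := by
  have hP := P.isApex_apex hκ.ne' φ
  set q := P.apex κ φ
  have hQ : Q.IsApex κ φ q := ⟨hP.1.trans h, hP.2.trans ((support_eq_iff hκ hC φ).1 h)⟩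
  obtain ⟨a, b, ε, hε, hab⟩ := P.exists_side_contacts κ φ hσ
  obtain ⟨a', b', δ, hδ, hab'⟩ := Q.exists_side_contacts κ φ hσ
  have hmin := eventually_Ioo (lt_min hε hδ)
  by_cases hqP : q ∈ P.verts
  · have hqQ : q ∈ Q.verts := by
      by_contra hc
      exact h₁ φ q ⟨hP, hQ, hqP, hc⟩
    filter_upwards [hmin] with t ht
    have h1 := hab t ⟨ht.1.le, ht.2.le.trans (min_le_left _ _)⟩
    have h2 := hab' t ⟨ht.1.le, ht.2.le.trans (min_le_right _ _)⟩
    rcases hσ with rfl | rfl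
    · rw [← h1.1.2, ← h2.1.2, hP.left_side_eq hκ hqP hε fun t ht => (hab t ht).1,
        hQ.left_side_eq hκ hqQ hδ fun t ht => (hab' t ht).1]
    -- Clockwise, only the right arm is known to stay at `q`, so the agreement is shown at the
    -- shifted direction.
    · rw [support_eq_iff hκ hC, add_right_comm, ← h1.2.2, ← h2.2.2,
        hP.right_side_eq hκ hqP hε fun t ht => (hab t ht).2,
        hQ.right_side_eq hκ hqQ hδ fun t ht => (hab' t ht).2]
  · have hqQ : q ∉ Q.verts := fun hc => h₂ φ q ⟨hQ, hP, hc, hqP⟩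
    refine eventually_support_eq hσ h (frequently_support_eq hκ hC hσ hP hQ hqQ hε
      (fun t ht => (hab t ht).1) (fun t ht => (hab t ht).2) ?_)
    rintro rfl
    have h0 := hab 0 ⟨le_rfl, hε.le⟩
    simp only [mul_zero, add_zero] at h0
    exact hqP (((hP.eq_foot hκ.ne' h0.1 h0.2).trans (foot_self hκ.ne' a φ)) ▸ h0.1.1)

theorem eq_of_not_mixed (hκ : 0 < sin κ)
    (hC : P.apexLocus κ = Q.apexLocus κ) (h₁ : ∀ φ q, ¬ IsMixedApex κ P Q φ q)
    (h₂ : ∀ φ q, ¬ IsMixedApex κ Q P φ q) : P = Q := by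
  have hclopen : IsClopen {φ | P.support φ = Q.support φ} := by
    refine ⟨isClosed_eq P.continuous_support Q.continuous_support, ?_⟩
    rw [isOpen_iff_mem_nhds]
    intro φ hφ
    have hr := eventually_support_eq_of_not_mixed hκ hC h₁ h₂ (Or.inl rfl) hφ
    have hl := eventually_support_eq_of_not_mixed hκ hC h₁ h₂ (Or.inr rfl) hφ
    obtain ⟨x, hx, hx'⟩ := (mem_nhdsGT_iff_exists_Ioo_subset.1 hr)
    obtain ⟨y, hy, hy'⟩ := (mem_nhdsGT_iff_exists_Ioo_subset.1 hl)
    refine Filter.mem_of_superset (Ioo_mem_nhds (show φ - y < φ by linarith [Set.mem_Ioi.1 hy])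
      (show φ < φ + x by linarith [Set.mem_Ioi.1 hx])) fun ψ hψ => ?_
    rcases lt_trichotomy ψ φ with hlt | rfl | hlt
    · have := hy' (show φ - ψ ∈ Set.Ioo 0 y from ⟨by linarith, by linarith [hψ.1]⟩)
      simpa using this
    · exact hφ
    · have := hx' (show ψ - φ ∈ Set.Ioo 0 x from ⟨by linarith, by linarith [hψ.2]⟩)
      simpa using this
  have huniv := hclopen.eq_univ (exists_support_eq hκ hC)
  exact eq_of_support_eq fun φ => Set.eq_univ_iff_forall.1 huniv φ

end ConvexPolygon

/-! ### Propagation of mixed apices -/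

namespace ConvexPolygon

variable {P Q : ConvexPolygon} {κ : ℝ}

theorem IsApex.contacts_ne {φ : ℝ} {q a b : ℂ} (hκ : sin κ ≠ 0) (h : P.IsApex κ φ q)
    (hq : q ∉ P.verts) (ha : P.IsContact φ a) (hb : P.IsContact (φ + κ) b) : a ≠ b := by
  rintro rfl
  exact hq (((h.eq_foot hκ ha hb).trans (foot_self hκ a φ)) ▸ ha.1)

/-- If the apex of `P` moved, agreement with `Q` on that side would give both polygons the same side
contacts. One of them is `q`, which would then be a vertex of `Q`. -/
theorem IsMixedApex.contact_side {φ σ : ℝ} {q : ℂ} (hκ : 0 < sin κ)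
    (hC : P.apexLocus κ = Q.apexLocus κ) (h : IsMixedApex κ P Q φ q) (hσ : σ = 1 ∨ σ = -1) :
    ∃ ε > 0, ∀ t ∈ Set.Icc 0 ε, P.IsContact (φ + σ * t) q ∧ P.IsContact (φ + κ + σ * t) q := by
  obtain ⟨a, b, ε, hε, hab⟩ := P.exists_side_contacts κ φ hσ
  have h0 := hab 0 ⟨le_rfl, hε.le⟩
  simp only [mul_zero, add_zero] at h0
  by_cases hne : a = b
  · subst hne
    have : q = a := (h.left.eq_foot hκ.ne' h0.1 h0.2).trans (foot_self hκ.ne' a φ)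
    rw [this]
    exact ⟨ε, hε, hab⟩
  · exfalso
    obtain ⟨a', b', δ, hδ, hab'⟩ := Q.exists_side_contacts κ φ hσ
    have hf := frequently_support_eq hκ hC hσ h.left h.right h.notMem hε
      (fun t ht => (hab t ht).1) (fun t ht => (hab t ht).2) hne
    rcases hσ with rfl | rfl
    · have e := side_contact_eq (Or.inl rfl) (lt_min hε hδ)
        (fun t ht => (hab t ⟨ht.1, ht.2.trans (min_le_left _ _)⟩).1)
        (fun t ht => (hab' t ⟨ht.1, ht.2.trans (min_le_right _ _)⟩).1)
        (h.left.1.symm.trans h.right.1) hf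
      rw [h.left.left_side_eq hκ h.mem hε fun t ht => (hab t ht).1] at e
      exact h.notMem (e ▸ (hab' 0 ⟨le_rfl, hδ.le⟩).1.1)
    · have e := side_contact_eq (Or.inr rfl) (lt_min hε hδ)
        (fun t ht => (hab t ⟨ht.1, ht.2.trans (min_le_left _ _)⟩).2)
        (fun t ht => (hab' t ⟨ht.1, ht.2.trans (min_le_right _ _)⟩).2)
        (h.left.2.symm.trans h.right.2)
        (hf.mono fun t ht => by rw [add_right_comm]; exact (support_eq_iff hκ hC _).1 ht)
      rw [h.left.right_side_eq hκ h.mem hε fun t ht => (hab t ht).2] at e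
      exact h.notMem (e ▸ (hab' 0 ⟨le_rfl, hδ.le⟩).2.1)

theorem IsMixedApex.contact_left {φ : ℝ} {q : ℂ} (h : IsMixedApex κ P Q φ q) :
    P.IsContact φ q := ⟨h.mem, h.left.1⟩

theorem IsMixedApex.contact_right {φ : ℝ} {q : ℂ} (h : IsMixedApex κ P Q φ q) :
    P.IsContact (φ + κ) q := ⟨h.mem, h.left.2⟩

/-- A second contact would lie ahead on the left arm, and a small clockwise turn would move it
beyond `q`, which is still a contact. -/
theorem IsMixedApex.left_unique {φ : ℝ} {q z : ℂ} (hκ : 0 < sin κ)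
    (hC : P.apexLocus κ = Q.apexLocus κ) (h : IsMixedApex κ P Q φ q) (hz : P.IsContact φ z) :
    z = q := by
  obtain ⟨τ, hτ, hτ0, hτn⟩ := h.left.left hκ hz
  refine hτ0 ?_
  obtain ⟨ε, hε, hc⟩ := h.contact_side hκ hC (Or.inr rfl : (-1 : ℝ) = 1 ∨ _)
  have ht0 : 0 < min ε (π / 2) := lt_min hε (by positivity)
  have h1 := (hc (min ε (π / 2)) ⟨ht0.le, min_le_left _ _⟩).1.2
  have h2 := proj_le_support hz.1 (φ + -1 * min ε (π / 2))
  rw [← h1, hτn, add_sub_cancel_left, neg_one_mul, sin_neg] at h2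
  have := sin_pos_of_pos_of_lt_pi ht0 ((min_le_right _ _).trans_lt (by linarith [pi_pos]))
  by_contra hne
  have : 0 < τ := lt_of_le_of_ne hτ (Ne.symm hne)
  nlinarith

theorem IsMixedApex.right_unique {φ : ℝ} {q z : ℂ} (hκ : 0 < sin κ)
    (hC : P.apexLocus κ = Q.apexLocus κ) (h : IsMixedApex κ P Q φ q)
    (hz : P.IsContact (φ + κ) z) : z = q := by
  obtain ⟨τ, hτ, hτ0, hτn⟩ := h.left.right hκ hz
  refine hτ0 ?_
  obtain ⟨ε, hε, hc⟩ := h.contact_side hκ hC (Or.inl rfl : (1 : ℝ) = 1 ∨ _)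
  have ht0 : 0 < min ε (π / 2) := lt_min hε (by positivity)
  have h1 := (hc (min ε (π / 2)) ⟨ht0.le, min_le_left _ _⟩).2.2
  have h2 := proj_le_support hz.1 (φ + κ + 1 * min ε (π / 2))
  rw [← h1, hτn, add_sub_cancel_left, one_mul] at h2
  have := sin_pos_of_pos_of_lt_pi ht0 ((min_le_right _ _).trans_lt (by linarith [pi_pos]))
  by_contra hne
  have : 0 < τ := lt_of_le_of_ne hτ (Ne.symm hne)
  nlinarith

/-- Mixed apices propagate, with the polygons exchanged. -/
theorem IsMixedApex.prev {φ : ℝ} {q : ℂ} (hκ : 0 < sin κ)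
    (hC : P.apexLocus κ = Q.apexLocus κ) (h : IsMixedApex κ P Q (φ + κ) q) :
    ∃ q', IsMixedApex κ Q P φ q' := by
  have hP := P.isApex_apex hκ.ne' φ
  set q' := P.apex κ φ
  have he : P.support (φ + κ) = Q.support (φ + κ) := h.left.1.symm.trans h.right.1
  have hQ : Q.IsApex κ φ q' := ⟨hP.1.trans ((support_eq_iff hκ hC φ).2 he), hP.2.trans he⟩
  have hqP : q' ∉ P.verts := by
    intro hc
    -- A contact `l` of `Q` then lies forward from `q` on the left arm at `φ + κ` and on the right
    -- arm at `φ`. These are opposite rays of one line, so `l = q`.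
    have hqq : q' = q := h.left_unique hκ hC ⟨hc, hP.2⟩
    obtain ⟨l, hl⟩ := Q.exists_isContact (φ + κ)
    obtain ⟨τ, hτ, hτ0, hτn⟩ := h.right.left hκ hl
    obtain ⟨υ, hυ, -, hυn⟩ := hQ.right hκ hl
    have h1 := hτn (φ + κ + π / 2)
    have h2 := hυn (φ + κ + π / 2)
    rw [hqq, add_sub_cancel_left, sin_pi_div_two] at h2
    rw [add_sub_cancel_left, sin_pi_div_two] at h1
    exact h.notMem (hτ0 (by linarith) ▸ hl.1)
  refine ⟨q', hQ, hP, ?_, hqP⟩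
  -- If `q'` is a vertex of neither polygon, the apex of `P` moves and the right contacts clockwise
  -- of `φ` agree; that of `P` is `q`.
  by_contra hqQ
  have hσ : (-1 : ℝ) = 1 ∨ (-1 : ℝ) = -1 := Or.inr rfl
  obtain ⟨a, b, ε, hε, hab⟩ := P.exists_side_contacts κ φ hσ
  obtain ⟨a', b', δ, hδ, hab'⟩ := Q.exists_side_contacts κ φ hσ
  have h0 := hab 0 ⟨le_rfl, hε.le⟩
  simp only [mul_zero, add_zero] at h0
  have hf := frequently_support_eq hκ hC hσ hP hQ hqQ hε
    (fun t ht => (hab t ht).1) (fun t ht => (hab t ht).2) (hP.contacts_ne hκ.ne' hqP h0.1 h0.2)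
  have e := side_contact_eq hσ (lt_min hε hδ)
    (fun t ht => (hab t ⟨ht.1, ht.2.trans (min_le_left _ _)⟩).2)
    (fun t ht => (hab' t ⟨ht.1, ht.2.trans (min_le_right _ _)⟩).2) he
    (hf.mono fun t ht => by rw [add_right_comm]; exact (support_eq_iff hκ hC _).1 ht)
  rw [h.left_unique hκ hC h0.2] at e
  exact h.notMem (e ▸ (hab' 0 ⟨le_rfl, hδ.le⟩).2.1)

/-! ### Circles between consecutive mixed apices -/

section Arc

variable {ψ : ℝ} {q₀ q₁ q₂ q₃ : ℂ}

/-- Between two consecutive mixed apices, the left contact of the first polygon is one of two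
vertices. -/
theorem left_contact_of_mixed (hκ₀ : 0 < κ) (hκπ : κ < π) (hC : P.apexLocus κ = Q.apexLocus κ)
    (h₂ : IsMixedApex κ P Q ψ q₂) (h₁ : IsMixedApex κ Q P (ψ + κ) q₁)
    (h₀ : IsMixedApex κ P Q (ψ + κ + κ) q₀) {φ ε : ℝ} (hφ : φ ∈ Set.Ioo (ψ + κ) (ψ + κ + κ))
    {d : ℂ} (hε : 0 < ε) (hd : ∀ t ∈ Set.Icc 0 ε, P.IsContact (φ + -1 * t) d) (hd0 : d ≠ q₀) :
    d = q₂ := by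
  have hκ := sin_pos_of_pos_of_lt_pi hκ₀ hκπ
  set n := ψ + κ + κ with hn
  have hd' := hd 0 ⟨le_rfl, hε.le⟩
  simp only [mul_zero, add_zero] at hd'
  -- Just clockwise of `φ`, the apices of `P` are apices of `Q` with left contact `q₁`; they lie on
  -- finitely many circles through `q₁`.
  have hev : ∀ᶠ t in 𝓝[>] (0 : ℝ), ∃ g ∈ Q.verts,
      foot κ d q₀ (φ + -1 * t) ∈ Metric.sphere (footCenter κ q₁ g) ‖footRadius κ q₁ g‖ := by
    filter_upwards [eventually_Ioo (lt_min hε (sub_pos.2 hφ.1))] with t ht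
    have htε : t ≤ ε := ht.2.le.trans (min_le_left _ _)
    have htφ : t < φ - (ψ + κ) := ht.2.trans_le (min_le_right _ _)
    have hdt := hd t ⟨ht.1.le, htε⟩
    set θ := φ + -1 * t with hθ
    have hθ1 : ψ + κ < θ := by rw [hθ]; linarith
    have hθ2 : θ < n := by rw [hθ]; linarith [hφ.2, ht.1]
    have hr : P.IsContact (θ + κ) q₀ := h₀.contact_left.of_mem_Icc h₀.contact_right hκ₀ hκπ
      ⟨by linarith, by linarith⟩
    have hy : P.IsApex κ θ (foot κ d q₀ θ) := isApex_foot hκ.ne' hdt hr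
    set y := foot κ d q₀ θ with hyd
    obtain ⟨τ, hτ, hτ0, hτn⟩ := hy.right hκ hr
    obtain ⟨υ, hυ, hυ0, hυn⟩ := hy.left hκ hdt
    have hτ1 : 0 < τ := by
      refine lt_of_le_of_ne hτ fun h => ?_
      have hq0y := hτ0 h.symm
      have hυ1 : 0 < υ := lt_of_le_of_ne hυ fun h => hd0 ((hυ0 h.symm).trans hq0y.symm)
      have h1 := hυn φ
      have h2 := (isContact_iff.1 hd').2 q₀ h₀.mem
      rw [h1, ← hq0y] at h2
      have := sin_pos_of_pos_of_lt_pi (x := φ - θ) (by rw [hθ]; linarith [ht.1])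
        (by linarith [hφ.2])
      nlinarith
    -- The supporting line of `Q` at `n` passes through `q₀`, and `y` is strictly beyond it. So `n`
    -- is interior to the cone of `y` for `Q`, which confines `θ'` to the interval from `ψ + κ` to
    -- `n`, modulo full turns.
    have hlt : Q.support n < proj y n := by
      rw [← h₀.right.1, hτn n, show n - (θ + κ) = -(θ - (ψ + κ)) by rw [hn]; ring, sin_neg]
      have := sin_pos_of_pos_of_lt_pi (x := θ - (ψ + κ)) (by linarith) (by linarith)
      nlinarith
    obtain ⟨θ', hθ'⟩ : y ∈ Q.apexLocus κ := hC ▸ ⟨θ, hy⟩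
    obtain ⟨hs1, hs2⟩ := hθ'.sin_of_lt hκ hlt
    have hl : Q.IsContact θ' q₁ := by
      have := h₁.contact_left.between h₁.contact_right hκ (s := θ' - (ψ + κ))
        (by
          rw [show n - (θ' + κ) = -(θ' - (ψ + κ)) by rw [hn]; ring, sin_neg] at hs2
          linarith)
        (by rw [show κ - (θ' - (ψ + κ)) = n - θ' by rw [hn]; ring]; exact hs1.le)
      rwa [add_sub_cancel] at this
    obtain ⟨g, hg⟩ := Q.exists_isContact (θ' + κ)
    refine ⟨g, hg.1, ?_⟩
    rw [hθ'.eq_foot hκ.ne' hl hg]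
    exact foot_mem_sphere _ _ _ _
  have hf : ∃ g ∈ Q.verts, ∃ᶠ t in 𝓝[>] (0 : ℝ),
      foot κ d q₀ (φ + -1 * t) ∈ Metric.sphere (footCenter κ q₁ g) ‖footRadius κ q₁ g‖ := by
    by_contra! hc
    obtain ⟨t, h1, g, hg, h2⟩ := (((eventually_all_finset Q.verts).2 hc).and hev).exists
    exact h1 g hg h2
  obtain ⟨g, -, hf⟩ := hf
  -- The circle of `d` and `q₀` is thus one of these circles and contains `q₁`.
  obtain ⟨hc, hr⟩ := eq_footCenter_of_frequently hκ.ne' hd0 (Or.inr rfl) hf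
  have hq1 := left_mem_sphere hκ.ne' q₁ g
  rw [hc, hr] at hq1
  obtain ⟨χ, hχ⟩ := exists_eq_foot_of_mem_sphere (footRadius_ne_zero hκ.ne' hd0) hq1
  obtain ⟨hχ1, hχ2⟩ := proj_foot hκ.ne' d q₀ χ
  rw [← hχ] at hχ1 hχ2
  have hne : q₁ ≠ q₀ := fun h => h₁.notMem (h ▸ h₀.mem)
  -- Both `χ + κ` and `ψ + κ + κ` are normal to the line through `q₁` and `q₀`, so `χ` and `ψ + κ`
  -- agree modulo π. Hence `d` is on the supporting line of `P` at `ψ + κ`, whose only contact is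
  -- `q₂`.
  have hs : sin (ψ + κ - χ) = 0 := by
    by_contra hs
    refine hne (eq_of_proj hχ2 (h₁.right.2.trans h₀.left.1.symm) ?_)
    rwa [show ψ + κ + κ - (χ + κ) = ψ + κ - χ by ring]
  have hd1 : proj (d - q₁) (ψ + κ) = 0 := by
    rw [proj_of_proj_eq_zero (φ := χ) (by rw [proj_sub, hχ1, sub_self]), hs, zero_mul]
  rw [proj_sub, sub_eq_zero] at hd1
  exact h₂.right_unique hκ hC ⟨hd'.1, hd1.trans h₁.right.1⟩

theorem apex_mem_sphere_of_mixed (hκ₀ : 0 < κ) (hκπ : κ < π)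
    (hC : P.apexLocus κ = Q.apexLocus κ)
    (h₂ : IsMixedApex κ P Q ψ q₂) (h₁ : IsMixedApex κ Q P (ψ + κ) q₁)
    (h₀ : IsMixedApex κ P Q (ψ + κ + κ) q₀) {φ : ℝ} (hφ : φ ∈ Set.Icc (ψ + κ) (ψ + κ + κ)) :
    P.apex κ φ ∈ Metric.sphere (footCenter κ q₂ q₀) ‖footRadius κ q₂ q₀‖ := by
  have hκ := sin_pos_of_pos_of_lt_pi hκ₀ hκπ
  have hx := P.isApex_apex hκ.ne' φ
  have hr : P.IsContact (φ + κ) q₀ := h₀.contact_left.of_mem_Icc h₀.contact_right hκ₀ hκπ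
      ⟨by linarith [hφ.1], by linarith [hφ.2]⟩
  rcases eq_or_lt_of_le hφ.1 with rfl | hl
  · rw [hx.eq_foot hκ.ne' h₂.contact_right hr]
    exact foot_mem_sphere _ _ _ _
  rcases eq_or_lt_of_le hφ.2 with rfl | hu
  · rw [hx.eq hκ.ne' h₀.left]
    exact right_mem_sphere hκ.ne' _ _
  obtain ⟨d, ε, hε, hd⟩ := P.exists_isContact_side φ (Or.inr rfl : (-1 : ℝ) = 1 ∨ _)
  have hd' := hd 0 ⟨le_rfl, hε.le⟩
  simp only [mul_zero, add_zero] at hd'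
  rw [hx.eq_foot hκ.ne' hd' hr]
  by_cases hd0 : d = q₀
  · rw [hd0, foot_self hκ.ne']
    exact right_mem_sphere hκ.ne' _ _
  · rw [left_contact_of_mixed hκ₀ hκπ hC h₂ h₁ h₀ ⟨hl, hu⟩ hε hd hd0]
    exact foot_mem_sphere _ _ _ _

/-- Between two consecutive mixed apices, both polygons have the same apices. -/
theorem exists_apex_eq_of_mixed (hκ₀ : 0 < κ) (hκπ : κ < π)
    (hC : P.apexLocus κ = Q.apexLocus κ)
    (h₂ : IsMixedApex κ P Q ψ q₂) (h₁ : IsMixedApex κ Q P (ψ + κ) q₁)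
    {φ : ℝ} (hφ : φ ∈ Set.Icc ψ (ψ + κ)) :
    ∃ θ ∈ Set.Icc ψ (ψ + κ), P.apex κ φ = Q.apex κ θ := by
  have hκ := sin_pos_of_pos_of_lt_pi hκ₀ hκπ
  have hy := P.isApex_apex hκ.ne' φ
  set y := P.apex κ φ
  have hl : P.IsContact φ q₂ := h₂.contact_left.of_mem_Icc h₂.contact_right hκ₀ hκπ hφ
  obtain ⟨τ, hτ, hτ0, hτn⟩ := hy.left hκ hl
  rcases eq_or_lt_of_le hτ with h0 | hτ1
  · exact ⟨ψ, ⟨le_rfl, by linarith⟩, (hτ0 h0.symm).symm.trans (h₂.right.eq_apex hκ.ne')⟩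
  rcases eq_or_lt_of_le hφ.2 with rfl | hu
  · exact ⟨ψ + κ, ⟨by linarith, le_rfl⟩, (hy.eq hκ.ne' h₁.right).trans (h₁.left.eq_apex hκ.ne')⟩
  -- The supporting line of `Q` at `ψ + κ` passes through `q₂`, and `y` lies beyond it; the cone of
  -- `y` for `Q` then confines `θ`.
  have hlt : Q.support (ψ + κ) < proj y (ψ + κ) := by
    have h1 := hτn (ψ + κ)
    rw [h₂.left.2, ← h₂.right.2.symm.trans h₂.left.2] at h1
    have := sin_pos_of_pos_of_lt_pi (x := ψ + κ - φ) (by linarith) (by linarith [hφ.1])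
    nlinarith
  obtain ⟨θ₀, hθ₀⟩ : y ∈ Q.apexLocus κ := hC ▸ ⟨φ, hy⟩
  obtain ⟨θ, hθ, hθy⟩ := hθ₀.exists_mem_Ico ψ
  obtain ⟨hs1, hs2⟩ := hθy.sin_of_lt hκ hlt
  rw [show ψ + κ - (θ + κ) = -(θ - ψ) by ring, sin_neg] at hs2
  have hθπ : θ - ψ < π := by
    by_contra hc
    have := sin_nonneg_of_nonneg_of_le_pi (x := θ - ψ - π) (by linarith) (by linarith [hθ.2])
    rw [sin_sub_pi] at this
    linarith
  have hθκ : θ ≤ ψ + κ := by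
    by_contra hc
    have := sin_nonpos_of_nonpos_of_neg_pi_le (x := ψ + κ - θ) (by linarith) (by linarith)
    linarith
  exact ⟨θ, ⟨hθ.1, hθκ⟩, hθy.eq_apex hκ.ne'⟩

/-- The circles of consecutive mixed apices agree. -/
theorem footCenter_eq_of_mixed (hκ₀ : 0 < κ) (hκπ : κ < π)
    (hC : P.apexLocus κ = Q.apexLocus κ) (h₃ : IsMixedApex κ Q P ψ q₃)
    (h₂ : IsMixedApex κ P Q (ψ + κ) q₂) (h₁ : IsMixedApex κ Q P (ψ + κ + κ) q₁)
    (h₀ : IsMixedApex κ P Q (ψ + κ + κ + κ) q₀) :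
    footCenter κ q₃ q₁ = footCenter κ q₂ q₀ ∧ ‖footRadius κ q₃ q₁‖ = ‖footRadius κ q₂ q₀‖ := by
  have hκ := sin_pos_of_pos_of_lt_pi hκ₀ hκπ
  have hne : q₂ ≠ q₀ := h₁.right.contacts_ne hκ.ne' h₁.notMem h₂.contact_right h₀.contact_left
  refine eq_footCenter_of_frequently hκ.ne' hne (Or.inr rfl) (φ := ψ + κ + κ) ?_
  -- Just clockwise of `ψ + κ + κ` the arms of `P` turn about `q₂` and `q₀`. The arc so traced
  -- consists of apices of `Q`, which lie on the circle of `q₃` and `q₁`.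
  obtain ⟨ε, hε, hl⟩ := h₂.contact_side hκ hC (Or.inr rfl)
  obtain ⟨δ, hδ, hr⟩ := h₀.contact_side hκ hC (Or.inr rfl)
  refine Eventually.frequently ?_
  filter_upwards [eventually_Ioo (lt_min (lt_min hε hδ) hκ₀)] with t ht
  have h1 := (hl t ⟨ht.1.le, ht.2.le.trans ((min_le_left _ _).trans (min_le_left _ _))⟩).2
  have h2 := (hr t ⟨ht.1.le, ht.2.le.trans ((min_le_left _ _).trans (min_le_right _ _))⟩).1
  have htκ : t < κ := ht.2.trans_le (min_le_right _ _)
  have hx : P.IsApex κ (ψ + κ + κ + -1 * t) (foot κ q₂ q₀ (ψ + κ + κ + -1 * t)) :=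
    isApex_foot hκ.ne' h1 (by rw [add_right_comm]; exact h2)
  obtain ⟨θ, hθ, he⟩ := exists_apex_eq_of_mixed hκ₀ hκπ hC h₂ h₁
    (φ := ψ + κ + κ + -1 * t) ⟨by linarith, by linarith [ht.1]⟩
  rw [hx.eq_apex hκ.ne', he]
  exact apex_mem_sphere_of_mixed hκ₀ hκπ hC.symm h₃ h₂ h₁ hθ

/-- Each step goes back by `κ` and exchanges the polygons, which is why both are quantified inside
the induction and both are controlled. -/
theorem apexes_mem_sphere_of_mixed (hκ₀ : 0 < κ) (hκπ : κ < π) (n : ℕ) :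
    ∀ (P Q : ConvexPolygon) (φ : ℝ) (q₂ q₀ : ℂ), P.apexLocus κ = Q.apexLocus κ →
      IsMixedApex κ P Q (φ - κ - κ) q₂ → IsMixedApex κ P Q φ q₀ →
      ∀ x ∈ Set.Icc (φ - n * κ) φ,
        P.apex κ x ∈ Metric.sphere (footCenter κ q₂ q₀) ‖footRadius κ q₂ q₀‖ ∧
        Q.apex κ x ∈ Metric.sphere (footCenter κ q₂ q₀) ‖footRadius κ q₂ q₀‖ := by
  have hκ := sin_pos_of_pos_of_lt_pi hκ₀ hκπ
  induction n with
  | zero =>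
    intro P Q φ q₂ q₀ hC h₂ h₀ x hx
    have : x = φ := le_antisymm hx.2 (by simpa using hx.1)
    rw [this, ← h₀.left.eq_apex hκ.ne', ← h₀.right.eq_apex hκ.ne']
    exact ⟨right_mem_sphere hκ.ne' _ _, right_mem_sphere hκ.ne' _ _⟩
  | succ n ih =>
    intro P Q φ q₂ q₀ hC h₂ h₀ x hx
    have h₀' : IsMixedApex κ P Q (φ - κ + κ) q₀ := by rwa [sub_add_cancel]
    obtain ⟨q₁, h₁⟩ := h₀'.prev hκ hC
    have h₂' : IsMixedApex κ P Q (φ - κ - κ - κ + κ) q₂ := by rwa [sub_add_cancel]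
    obtain ⟨q₃, h₃⟩ := h₂'.prev hκ hC
    have h₁'' : IsMixedApex κ Q P (φ - κ - κ + κ) q₁ := by rwa [sub_add_cancel]
    have h₁' : IsMixedApex κ Q P (φ - κ - κ - κ + κ + κ) q₁ := by simpa using h₁
    have h₀'' : IsMixedApex κ P Q (φ - κ - κ + κ + κ) q₀ := by simpa using h₀
    rcases le_total (φ - κ) x with hx' | hx'
    · have hin : ∀ y ∈ Set.Icc (φ - κ) φ,
          P.apex κ y ∈ Metric.sphere (footCenter κ q₂ q₀) ‖footRadius κ q₂ q₀‖ := fun y hy =>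
        apex_mem_sphere_of_mixed hκ₀ hκπ hC h₂ h₁'' h₀''
          ⟨by linarith [hy.1], by linarith [hy.2]⟩
      refine ⟨hin x ⟨hx', hx.2⟩, ?_⟩
      obtain ⟨θ, hθ, he⟩ := exists_apex_eq_of_mixed hκ₀ hκπ hC.symm h₁ h₀'
        ⟨hx', by linarith [hx.2]⟩
      rw [he]
      exact hin θ ⟨hθ.1, by linarith [hθ.2]⟩
    · obtain ⟨hc, hr⟩ := footCenter_eq_of_mixed hκ₀ hκπ hC h₃ h₂' h₁'
        (by simpa using h₀)
      have := ih Q P (φ - κ) q₃ q₁ hC.symm h₃ h₁ x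
        ⟨by have := hx.1; push_cast at this; linarith, hx'⟩
      rw [hc, hr] at this
      exact this.symm

end Arc

/-- If there is a mixed apex, all apices lie on one circle. -/
theorem IsMixedApex.exists_sphere (hκ₀ : 0 < κ) (hκπ : κ < π)
    (hC : P.apexLocus κ = Q.apexLocus κ) {φ : ℝ} {q : ℂ} (h : IsMixedApex κ P Q φ q) :
    ∃ c r, 0 < r ∧ P.apexLocus κ ⊆ Metric.sphere c r := by
  have hκ := sin_pos_of_pos_of_lt_pi hκ₀ hκπ
  have h' : IsMixedApex κ P Q (φ - κ + κ) q := by rwa [sub_add_cancel]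
  obtain ⟨q₁, h₁⟩ := h'.prev hκ hC
  have h₁' : IsMixedApex κ Q P (φ - κ - κ + κ) q₁ := by rwa [sub_add_cancel]
  obtain ⟨q₂, h₂⟩ := h₁'.prev hκ hC.symm
  have hne : q₂ ≠ q := h₁'.right.contacts_ne hκ.ne' h₁'.notMem h₂.contact_right
    (by simpa using h.contact_left)
  refine ⟨footCenter κ q₂ q, _, norm_pos_iff.2 (footRadius_ne_zero hκ.ne' hne), ?_⟩
  rintro x ⟨ψ, hψ⟩
  obtain ⟨θ, hθ, hθx⟩ := hψ.exists_mem_Ico (φ - 2 * π)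
  -- Enough steps of length `κ` for a full turn.
  obtain ⟨n, hn⟩ := exists_nat_ge (2 * π / κ)
  rw [div_le_iff₀ hκ₀] at hn
  rw [hθx.eq_apex hκ.ne']
  exact (apexes_mem_sphere_of_mixed hκ₀ hκπ n P Q φ q₂ q hC h₂ h θ
    ⟨by linarith [hθ.1], by linarith [hθ.2]⟩).1

/-- A polygon is determined by its apex locus, unless that lies on a circle. -/
theorem eq_of_apexLocus_eq (hκ₀ : 0 < κ) (hκπ : κ < π) (hC : P.apexLocus κ = Q.apexLocus κ)
    (hcirc : ∀ c r, 0 < r → ¬ P.apexLocus κ ⊆ Metric.sphere c r) : P = Q := by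
  refine eq_of_not_mixed (sin_pos_of_pos_of_lt_pi hκ₀ hκπ) hC (fun φ q h => ?_) fun φ q h => ?_
  · obtain ⟨c, r, hr, hs⟩ := h.exists_sphere hκ₀ hκπ hC
    exact hcirc c r hr hs
  · obtain ⟨c, r, hr, hs⟩ := h.exists_sphere hκ₀ hκπ hC.symm
    exact hcirc c r hr (hC ▸ hs)

end ConvexPolygon

/-! ### Minimal wedges as apices, and density of the open arcs -/

namespace ConvexPolygon

variable {P Q : ConvexPolygon} {ω κ : ℝ}

theorem proj_le_support_of_mem_region {z : ℂ} (hz : z ∈ P.region) (φ : ℝ) :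
    proj z φ ≤ P.support φ := by
  have hlin : IsLinearMap ℝ fun z : ℂ => proj z φ :=
    ⟨fun x y => proj_add x y φ, fun c x => by simp [proj]; ring⟩
  exact convexHull_min (fun v hv => proj_le_support hv φ) (convex_halfSpace_le hlin _) hz

theorem subset_region (P : ConvexPolygon) : (P.verts : Set ℂ) ⊆ P.region :=
  subset_convexHull ℝ _

section Wedge

variable {q z : ℂ} {θ : ℝ}

theorem proj_wedge (ω : ℝ) (q : ℂ) (θ s t : ℝ) :
    proj (q + s * Complex.exp ((θ - ω / 2 : ℝ) * Complex.I)
      + t * Complex.exp ((θ + ω / 2 : ℝ) * Complex.I)) (θ + ω / 2 + π / 2) =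
        proj q (θ + ω / 2 + π / 2) - s * sin ω ∧
    proj (q + s * Complex.exp ((θ - ω / 2 : ℝ) * Complex.I)
      + t * Complex.exp ((θ + ω / 2 : ℝ) * Complex.I)) (θ + ω / 2 + π / 2 + (π - ω)) =
        proj q (θ + ω / 2 + π / 2 + (π - ω)) - t * sin ω := by
  simp only [proj_add, proj_ofReal_mul_exp]
  rw [show θ - ω / 2 - (θ + ω / 2 + π / 2) = -(ω + π / 2) by ring,
    show θ + ω / 2 - (θ + ω / 2 + π / 2) = -(π / 2) by ring,
    show θ - ω / 2 - (θ + ω / 2 + π / 2 + (π - ω)) = -(π / 2 + π) by ring,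
    show θ + ω / 2 - (θ + ω / 2 + π / 2 + (π - ω)) = -((π / 2 - ω) + π) by ring]
  simp only [cos_neg, cos_add_pi, cos_add_pi_div_two, cos_pi_div_two_sub, cos_pi_div_two]
  constructor <;> ring

theorem eq_wedge_combination (hω₀ : 0 < ω) (hω₁ : ω < π) (q z : ℂ) (θ : ℝ) :
    z = q + ((proj q (θ + ω / 2 + π / 2) - proj z (θ + ω / 2 + π / 2)) / sin ω : ℝ)
        * Complex.exp ((θ - ω / 2 : ℝ) * Complex.I)
      + ((proj q (θ + ω / 2 + π / 2 + (π - ω)) - proj z (θ + ω / 2 + π / 2 + (π - ω))) / sin ω : ℝ)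
        * Complex.exp ((θ + ω / 2 : ℝ) * Complex.I) := by
  have hs := sin_pos_of_pos_of_lt_pi hω₀ hω₁
  refine eq_of_proj (φ := θ + ω / 2 + π / 2) (ψ := θ + ω / 2 + π / 2 + (π - ω)) ?_ ?_ ?_
  · rw [(proj_wedge ω q θ _ _).1]; field_simp; ring
  · rw [(proj_wedge ω q θ _ _).2]; field_simp; ring
  · rw [add_sub_cancel_left, sin_pi_sub]; exact hs.ne'

theorem mem_wedge_iff (hω₀ : 0 < ω) (hω₁ : ω < π) : z ∈ wedge ω q θ ↔
    proj z (θ + ω / 2 + π / 2) ≤ proj q (θ + ω / 2 + π / 2) ∧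
    proj z (θ + ω / 2 + π / 2 + (π - ω)) ≤ proj q (θ + ω / 2 + π / 2 + (π - ω)) := by
  have hs := sin_pos_of_pos_of_lt_pi hω₀ hω₁
  constructor
  · rintro ⟨s, t, hs0, ht0, rfl⟩
    rw [(proj_wedge ω q θ s t).1, (proj_wedge ω q θ s t).2]
    exact ⟨by nlinarith, by nlinarith⟩
  · rintro ⟨h1, h2⟩
    exact ⟨_, _, div_nonneg (by linarith) hs.le, div_nonneg (by linarith) hs.le,
      eq_wedge_combination hω₀ hω₁ q z θ⟩

theorem mem_leftArm_iff (hω₀ : 0 < ω) (hω₁ : ω < π) : z ∈ leftArm ω q θ ↔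
    proj z (θ + ω / 2 + π / 2) = proj q (θ + ω / 2 + π / 2) ∧
    proj z (θ + ω / 2 + π / 2 + (π - ω)) ≤ proj q (θ + ω / 2 + π / 2 + (π - ω)) := by
  have hs := sin_pos_of_pos_of_lt_pi hω₀ hω₁
  constructor
  · rintro ⟨t, ht0, rfl⟩
    have := proj_wedge ω q θ 0 t
    simp only [Complex.ofReal_zero, zero_mul, add_zero, sub_zero] at this
    rw [this.1, this.2]
    exact ⟨rfl, by nlinarith⟩
  · rintro ⟨h1, h2⟩
    have := eq_wedge_combination hω₀ hω₁ q z θ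
    rw [h1, sub_self, zero_div, Complex.ofReal_zero, zero_mul, add_zero] at this
    exact ⟨_, div_nonneg (by linarith) hs.le, this⟩

theorem mem_rightArm_iff (hω₀ : 0 < ω) (hω₁ : ω < π) : z ∈ rightArm ω q θ ↔
    proj z (θ + ω / 2 + π / 2 + (π - ω)) = proj q (θ + ω / 2 + π / 2 + (π - ω)) ∧
    proj z (θ + ω / 2 + π / 2) ≤ proj q (θ + ω / 2 + π / 2) := by
  have hs := sin_pos_of_pos_of_lt_pi hω₀ hω₁
  constructor
  · rintro ⟨t, ht0, rfl⟩
    have := proj_wedge ω q θ t 0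
    simp only [Complex.ofReal_zero, zero_mul, add_zero, sub_zero] at this
    rw [this.1, this.2]
    exact ⟨rfl, by nlinarith⟩
  · rintro ⟨h1, h2⟩
    have := eq_wedge_combination hω₀ hω₁ q z θ
    rw [h1, sub_self, zero_div, Complex.ofReal_zero, zero_mul, add_zero] at this
    exact ⟨_, div_nonneg (by linarith) hs.le, this⟩

end Wedge

/-- The outer normal of the left arm is a quarter turn counterclockwise from it, and that of the
right arm is `π - ω` further. -/
theorem isMinimalWedge_iff (hω₀ : 0 < ω) (hω₁ : ω < π) {q : ℂ} {θ : ℝ} :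
    IsMinimalWedge ω P q θ ↔ P.IsApex (π - ω) (θ + ω / 2 + π / 2) q := by
  constructor
  · rintro ⟨h, ⟨l, hl, hlP⟩, r, hr, hrP⟩
    have hle := fun v (hv : v ∈ P.verts) => (mem_wedge_iff hω₀ hω₁).1 (h (P.subset_region hv))
    constructor
    · refine le_antisymm ?_ ?_
      · rw [← ((mem_leftArm_iff hω₀ hω₁).1 hl).1]
        exact proj_le_support_of_mem_region hlP _
      · obtain ⟨v, hv⟩ := P.exists_isContact (θ + ω / 2 + π / 2)
        rw [← hv.2]
        exact (hle v hv.1).1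
    · refine le_antisymm ?_ ?_
      · rw [← ((mem_rightArm_iff hω₀ hω₁).1 hr).1]
        exact proj_le_support_of_mem_region hrP _
      · obtain ⟨v, hv⟩ := P.exists_isContact (θ + ω / 2 + π / 2 + (π - ω))
        rw [← hv.2]
        exact (hle v hv.1).2
  · intro h
    refine ⟨fun z hz => (mem_wedge_iff hω₀ hω₁).2 ?_, ?_, ?_⟩
    · rw [h.1, h.2]
      exact ⟨proj_le_support_of_mem_region hz _, proj_le_support_of_mem_region hz _⟩
    · obtain ⟨v, hv⟩ := P.exists_isContact (θ + ω / 2 + π / 2)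
      refine ⟨v, (mem_leftArm_iff hω₀ hω₁).2 ⟨hv.2.trans h.1.symm, ?_⟩, P.subset_region hv.1⟩
      rw [h.2]
      exact proj_le_support hv.1 _
    · obtain ⟨v, hv⟩ := P.exists_isContact (θ + ω / 2 + π / 2 + (π - ω))
      refine ⟨v, (mem_rightArm_iff hω₀ hω₁).2 ⟨hv.2.trans h.2.symm, ?_⟩, P.subset_region hv.1⟩
      rw [h.1]
      exact proj_le_support hv.1 _

theorem omegaCloud_eq_apexLocus (hω₀ : 0 < ω) (hω₁ : ω < π) (P : ConvexPolygon) :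
    omegaCloud ω P = P.apexLocus (π - ω) := by
  ext q
  simp only [omegaCloud, isMinimalWedge_iff hω₀ hω₁, apexLocus, Set.mem_ofPred_eq]
  refine ⟨fun ⟨θ, h⟩ => ⟨_, h⟩, fun ⟨φ, h⟩ => ⟨φ - ω / 2 - π / 2, ?_⟩⟩
  rwa [show φ - ω / 2 - π / 2 + ω / 2 + π / 2 = φ by ring]

theorem mem_touchingPart (hω₀ : 0 < ω) (hω₁ : ω < π) {φ : ℝ} {q a b : ℂ}
    (h : P.IsApex (π - ω) φ q) (ha : ∀ z, P.IsContact φ z ↔ z = a)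
    (hb : ∀ z, P.IsContact (φ + (π - ω)) z ↔ z = b) : q ∈ touchingPart ω P a b := by
  have e : φ - ω / 2 - π / 2 + ω / 2 + π / 2 = φ := by ring
  refine ⟨omegaCloud_eq_apexLocus hω₀ hω₁ P ▸ ⟨φ, h⟩, φ - ω / 2 - π / 2,
    (isMinimalWedge_iff hω₀ hω₁).2 (e.symm ▸ h), ?_, ?_⟩
  · ext z
    rw [Set.mem_inter_iff, mem_leftArm_iff hω₀ hω₁, e, Set.mem_singleton_iff, ← ha, h.1, h.2]
    exact ⟨fun hz => ⟨hz.2, hz.1.1⟩, fun hz => ⟨⟨hz.2, proj_le_support hz.1 _⟩, hz.1⟩⟩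
  · ext z
    rw [Set.mem_inter_iff, mem_rightArm_iff hω₀ hω₁, e, Set.mem_singleton_iff, ← hb, h.1, h.2]
    exact ⟨fun hz => ⟨hz.2, hz.1.1⟩, fun hz => ⟨⟨hz.2, proj_le_support hz.1 _⟩, hz.1⟩⟩

theorem IsContact.unique {φ s : ℝ} {a z : ℂ} (hs : 0 < s) (hsπ : s < π)
    (h₁ : P.IsContact (φ - s) a) (h₂ : P.IsContact (φ + s) a) (ha : P.IsContact φ a)
    (hz : P.IsContact φ z) : z = a := by
  have h0 : proj (z - a) φ = 0 := by rw [proj_sub, ha.2, hz.2, sub_self]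
  have hall := proj_of_proj_eq_zero h0
  have e1 : proj (z - a) (φ - s) ≤ 0 := by
    rw [proj_sub, h₁.2]; linarith [proj_le_support hz.1 (φ - s)]
  have e2 : proj (z - a) (φ + s) ≤ 0 := by
    rw [proj_sub, h₂.2]; linarith [proj_le_support hz.1 (φ + s)]
  rw [hall, sub_sub_cancel_left, sin_neg] at e1
  rw [hall, add_sub_cancel_left] at e2
  have := sin_pos_of_pos_of_lt_pi hs hsπ
  refine sub_eq_zero.1 (eq_zero_of_proj h0 (ψ := φ + π / 2) ?_ (by simp))
  apply le_antisymm <;> by_contra hc <;> nlinarith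

/-- The points at which the arms touch exactly one vertex each, and different ones. -/
def openArcs (ω : ℝ) (P : ConvexPolygon) : Set ℂ :=
  {x | ∃ a b, a ≠ b ∧ x ∈ touchingPart ω P a b}

theorem mem_closure_openArcs_of_ne (hω₀ : 0 < ω) (hω₁ : ω < π) {φ ε : ℝ} {q a b : ℂ}
    (h : P.IsApex (π - ω) φ q) (hε : 0 < ε)
    (hab : ∀ t ∈ Set.Icc 0 ε, P.IsContact (φ + -1 * t) a ∧ P.IsContact (φ + (π - ω) + -1 * t) b)
    (hne : a ≠ b) : q ∈ closure (openArcs ω P) := by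
  have hκ : 0 < sin (π - ω) := by rw [sin_pi_sub]; exact sin_pos_of_pos_of_lt_pi hω₀ hω₁
  have h0 := hab 0 ⟨le_rfl, hε.le⟩
  simp only [mul_zero, add_zero] at h0
  have hq := h.eq_foot hκ.ne' h0.1 h0.2
  have htend : Tendsto (fun t => foot (π - ω) a b (φ + -1 * t)) (𝓝[>] (0 : ℝ)) (𝓝 q) := by
    have : Continuous fun t : ℝ => foot (π - ω) a b (φ + -1 * t) :=
      (continuous_foot _ a b).comp (by fun_prop)
    have := (this.tendsto 0).mono_left (nhdsWithin_le_nhds (s := Set.Ioi 0))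
    simpa [← hq] using this
  refine mem_closure_of_tendsto htend ?_
  filter_upwards [eventually_Ioo hε, eventually_Ioo pi_pos] with t ht htπ
  have ht' := hab t ⟨ht.1.le, ht.2.le⟩
  -- Keeps both neighbours of `t` in the contact interval; in its interior the contacts are unique.
  have hs : 0 < min t (ε - t) := lt_min ht.1 (by linarith [ht.2])
  have hsπ : min t (ε - t) < π := (min_le_left _ _).trans_lt htπ.2
  have hp := hab (t + min t (ε - t)) ⟨by linarith [ht.1],
    by linarith [min_le_right t (ε - t)]⟩
  have hm := hab (t - min t (ε - t)) ⟨by linarith [min_le_left t (ε - t)], by linarith [ht.2]⟩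
  have ep (x : ℝ) : x + -1 * (t + min t (ε - t)) = x + -1 * t - min t (ε - t) := by ring
  have em (x : ℝ) : x + -1 * (t - min t (ε - t)) = x + -1 * t + min t (ε - t) := by ring
  rw [ep, ep] at hp
  rw [em, em] at hm
  refine ⟨a, b, hne, mem_touchingPart hω₀ hω₁
    (isApex_foot hκ.ne' ht'.1 (by rw [add_right_comm]; exact ht'.2))
    (fun z => ⟨fun hz => hp.1.unique hs hsπ hm.1 ht'.1 hz, fun hz => hz ▸ ht'.1⟩) fun z => ?_⟩
  rw [add_right_comm]
  exact ⟨fun hz => hp.2.unique hs hsπ hm.2 ht'.2 hz, fun hz => hz ▸ ht'.2⟩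

/-- An apex resting at `q` for a full turn would make the support function that of a point, but
there are two vertices. -/
theorem exists_apex_ne (P : ConvexPolygon) (hκ : sin κ ≠ 0) (φ : ℝ) (q : ℂ) :
    ∃ t, 0 ≤ t ∧ P.apex κ (φ + -1 * t) ≠ q := by
  by_contra! hc
  have hall : ∀ n, P.support n = proj q n := by
    intro n
    obtain ⟨m, hm, -⟩ := existsUnique_add_zsmul_mem_Ico two_pi_pos n (φ - 2 * π)
    have hm' : n + m * (2 * π) ∈ Set.Ico (φ - 2 * π) (φ - 2 * π + 2 * π) := by simpa using hm
    have h1 := hc (φ - (n + m * (2 * π))) (by linarith [hm'.2])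
    have h2 := (P.isApex_apex hκ (φ + -1 * (φ - (n + m * (2 * π))))).1
    rw [h1, show φ + -1 * (φ - (n + m * (2 * π))) = n + m * (2 * π) by ring,
      support_add_int_mul] at h2
    rw [← h2]
    exact (show Function.Periodic (proj q) (2 * π) from proj_add_two_pi q).int_mul m n
  have hv : ∀ v ∈ P.verts, v = q := by
    intro v hv
    have h0 : ∀ n, proj (v - q) n = 0 := by
      intro n
      have h1 := proj_le_support hv n
      have h2 := proj_le_support hv (n + π)
      rw [hall] at h1 h2
      rw [proj_add_pi, proj_add_pi] at h2
      rw [proj_sub]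
      linarith
    exact sub_eq_zero.1 (eq_zero_of_proj (h0 0) (h0 (π / 2)) (by simp))
  have := P.two_le_card
  obtain ⟨x, hx, y, hy, hxy⟩ := Finset.one_lt_card.1 (by omega : 1 < P.verts.card)
  exact hxy ((hv x hx).trans (hv y hy).symm)

theorem apexLocus_subset_closure (hω₀ : 0 < ω) (hω₁ : ω < π) (P : ConvexPolygon) :
    P.apexLocus (π - ω) ⊆ closure (openArcs ω P) := by
  rintro q ⟨φ, hq⟩
  have hκ : 0 < sin (π - ω) := by rw [sin_pi_sub]; exact sin_pos_of_pos_of_lt_pi hω₀ hω₁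
  have hqφ := hq.eq_apex hκ.ne'
  -- The clockwise turn `T` is where the apex finally leaves `q`. Equal contacts just after it would
  -- prolong the rest, so an open arc starts there.
  set S := {t : ℝ | 0 ≤ t ∧ P.apex (π - ω) (φ + -1 * t) ≠ q} with hS
  have hne : S.Nonempty := P.exists_apex_ne hκ.ne' φ q
  have hbdd : BddBelow S := ⟨0, fun t ht => ht.1⟩
  set T := sInf S with hT
  have hT0 : 0 ≤ T := le_csInf hne fun t ht => ht.1
  have hbefore : ∀ t, 0 ≤ t → t < T → P.apex (π - ω) (φ + -1 * t) = q := by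
    intro t ht htT
    by_contra hc
    exact absurd (csInf_le hbdd (show t ∈ S from ⟨ht, hc⟩)) (not_le.2 htT)
  have hcont : Continuous fun t : ℝ => P.apex (π - ω) (φ + -1 * t) :=
    (P.continuous_apex _).comp (by fun_prop)
  have hTq : P.apex (π - ω) (φ + -1 * T) = q := by
    rcases eq_or_lt_of_le hT0 with h0 | h0
    · rw [← h0]; simpa using hqφ.symm
    · have hcl : IsClosed {t : ℝ | P.apex (π - ω) (φ + -1 * t) = q} :=
        isClosed_eq hcont continuous_const
      have : closure (Set.Ico 0 T) ⊆ {t : ℝ | P.apex (π - ω) (φ + -1 * t) = q} :=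
        hcl.closure_subset_iff.2 fun t ht => hbefore t ht.1 ht.2
      rw [closure_Ico h0.ne] at this
      exact this ⟨hT0, le_rfl⟩
  have hap : P.IsApex (π - ω) (φ + -1 * T) q := hTq ▸ P.isApex_apex hκ.ne' _
  obtain ⟨a, b, ε, hε, hab⟩ := P.exists_side_contacts (π - ω) (φ + -1 * T) (Or.inr rfl)
  refine mem_closure_openArcs_of_ne hω₀ hω₁ hap hε hab ?_
  rintro rfl
  have hpause : ∀ t ∈ Set.Icc 0 ε, P.apex (π - ω) (φ + -1 * (T + t)) = a := by
    intro t ht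
    have h1 := hab t ht
    have h2 := P.isApex_apex hκ.ne' (φ + -1 * T + -1 * t)
    rw [show φ + -1 * (T + t) = φ + -1 * T + -1 * t by ring,
      h2.eq_foot hκ.ne' h1.1 (by rw [add_right_comm]; exact h1.2), foot_self hκ.ne']
  have haq : a = q := by rw [← hpause 0 ⟨le_rfl, hε.le⟩, add_zero, hTq]
  obtain ⟨t, ht, htlt⟩ := exists_lt_of_csInf_lt hne (show sInf S < T + ε by linarith)
  have htT : T ≤ t := csInf_le hbdd ht
  refine ht.2 ?_
  have := hpause (t - T) ⟨by linarith, by linarith⟩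
  rwa [add_sub_cancel, haq] at this

theorem isClosed_apexLocus (P : ConvexPolygon) (hκ : sin κ ≠ 0) : IsClosed (P.apexLocus κ) := by
  have : P.apexLocus κ = P.apex κ '' Set.Icc 0 (2 * π) := by
    ext q
    constructor
    · rintro ⟨φ, h⟩
      obtain ⟨ψ, hψ, hψq⟩ := h.exists_mem_Ico 0
      exact ⟨ψ, ⟨hψ.1, by linarith [hψ.2]⟩, (hψq.eq_apex hκ).symm⟩
    · rintro ⟨ψ, -, rfl⟩
      exact ⟨ψ, P.isApex_apex hκ ψ⟩
  rw [this]
  exact (isCompact_Icc.image (P.continuous_apex κ)).isClosed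

theorem closure_openArcs (hω₀ : 0 < ω) (hω₁ : ω < π) (P : ConvexPolygon) :
    closure (openArcs ω P) = P.apexLocus (π - ω) := by
  refine (P.apexLocus_subset_closure hω₀ hω₁).antisymm' (closure_minimal ?_ ?_)
  · rintro x ⟨a, b, -, hx⟩
    exact omegaCloud_eq_apexLocus hω₀ hω₁ P ▸ hx.1
  · refine P.isClosed_apexLocus ?_
    rw [sin_pi_sub]
    exact (sin_pos_of_pos_of_lt_pi hω₀ hω₁).ne'

end ConvexPolygon

/-! ### From arc sequences to apex loci -/

open ConvexPolygon

/-- The components of the touching parts cover `openArcs ω P`, and for finitely many sets closure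
commutes with union. -/
theorem IsCloudSequence.exists_mem_iff {ω : ℝ} (hω₀ : 0 < ω) (hω₁ : ω < π) {P : ConvexPolygon}
    {Ω : Cycle (Set ℂ)} (h : IsCloudSequence ω P Ω) (x : ℂ) :
    (∃ Γ ∈ Ω, x ∈ Γ) ↔ x ∈ P.apexLocus (π - ω) := by
  obtain ⟨n, γ, -, hγ, -, -, -, -, rfl⟩ := h
  have hU : ⋃ i, γ i = openArcs ω P := by
    ext y
    rw [Set.mem_iUnion]
    constructor
    · rintro ⟨i, hi⟩
      obtain ⟨a, b, hab, z, -, hz⟩ := (hγ (γ i)).2 ⟨i, rfl⟩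
      exact ⟨a, b, hab, connectedComponentIn_subset _ _ (hz ▸ hi)⟩
    · rintro ⟨a, b, hab, hy⟩
      obtain ⟨i, hi⟩ := (hγ _).1 ⟨a, b, hab, y, hy, rfl⟩
      exact ⟨i, hi ▸ mem_connectedComponentIn hy⟩
  rw [← closure_openArcs hω₀ hω₁, ← hU, closure_iUnion_of_finite, Set.mem_iUnion]
  simp [List.mem_ofFn]

theorem IsMaximalCloud.exists_mem_iff {ω : ℝ} (hω₀ : 0 < ω) (hω₁ : ω < π) {P : ConvexPolygon}
    {Ω' : CircularArcSequence} (h : IsMaximalCloud ω P Ω') (x : ℂ) :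
    (∃ Γ ∈ Ω'.arcs, x ∈ Γ) ↔ x ∈ P.apexLocus (π - ω) := by
  obtain ⟨blocks, hseq, -, -, -, hΩ⟩ := h
  rw [← hseq.exists_mem_iff hω₀ hω₁, hΩ]
  simp only [Cycle.mem_coe_iff, List.mem_map, List.mem_flatten]
  constructor
  · rintro ⟨_, ⟨B, hB, rfl⟩, hx⟩
    obtain ⟨Γ, hΓ, hx⟩ := Set.mem_iUnion₂.1 hx
    exact ⟨Γ, ⟨B, hB, hΓ⟩, hx⟩
  · rintro ⟨Γ, ⟨B, hB, hΓ⟩, hx⟩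
    exact ⟨_, ⟨B, hB, rfl⟩, Set.mem_iUnion₂.2 ⟨Γ, hΓ, hx⟩⟩

theorem IsMaximalCloud.not_subset_sphere {ω : ℝ} (hω₀ : 0 < ω) (hω₁ : ω < π) {P : ConvexPolygon}
    {Ω' : CircularArcSequence} (h : IsMaximalCloud ω P Ω') (hlen : 2 ≤ Ω'.arcs.length) (c : ℂ)
    (r : ℝ) (hr : 0 < r) : ¬ P.apexLocus (π - ω) ⊆ Metric.sphere c r := by
  intro hs
  obtain ⟨blocks, hseq, hne, -, hchain, hΩ⟩ := h
  rw [hΩ, Cycle.length_coe, List.length_map] at hlen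
  have hch := hchain hlen
  have hsub : ∀ B ∈ blocks, ∀ Γ ∈ B, Γ ⊆ Metric.sphere c r := fun B hB Γ hΓ x hx =>
    hs ((hseq.exists_mem_iff hω₀ hω₁ x).1
      ⟨Γ, Cycle.mem_coe_iff.2 (List.mem_flatten.2 ⟨B, hB, hΓ⟩), hx⟩)
  -- The first two blocks already lie on different circles.
  match blocks, hlen with
  | B :: B' :: rest, _ =>
    rw [Cycle.chain_coe_cons, List.cons_append, List.isChain_cons_cons] at hch
    obtain ⟨Γ, hΓ⟩ := List.exists_mem_of_ne_nil _ (hne B (by simp))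
    obtain ⟨Γ', hΓ'⟩ := List.exists_mem_of_ne_nil _ (hne B' (by simp))
    exact hch.1 Γ hΓ Γ' hΓ' ⟨c, r, hr, hsub B (by simp) Γ hΓ, hsub B' (by simp) Γ' hΓ'⟩

theorem theorem2 (ω : ℝ) (hω₀ : 0 < ω) (hω₁ : ω < Real.pi)
    (Ω' : CircularArcSequence) (hΩ' : 2 ≤ Ω'.arcs.length)
    (P Q : ConvexPolygon) (hP : IsMaximalCloud ω P Ω') (hQ : IsMaximalCloud ω Q Ω') :
    P = Q := by
  refine eq_of_apexLocus_eq (sub_pos.2 hω₁) (sub_lt_self _ hω₀) ?_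
    (hP.not_subset_sphere hω₀ hω₁ hΩ')
  ext x
  rw [← hP.exists_mem_iff hω₀ hω₁, hQ.exists_mem_iff hω₀ hω₁]
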